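/- Let $d\ge 0$, $M\ge N\ge 2$ be integers, $a\in\mathbb{R}\setminus\{0\}$, and let $B_1$ be a real $d\times d$ matrix; if $M=N$, assume that $B_1+l\,a\,\mathrm{Id}$ is invertible for every integer $l\ge 2$ (no condition on $B_1$ if $M>N$). Let $X$ be a real-analytic vector field on an open neighbourhood $U$ of the origin of $\mathbb{R}\times\mathbb{R}^d$ of the form $$X(x,y)=\bigl(-ax^N+f_N(x,y)+f_{\ge N+1}(x,y),\; x^{M-1}B_1y+g_M(x,y)+g_{\ge M+1}(x,y)\bigr),$$ where $f_N$ is a homogeneous polynomial of degree $N$ with $f_N(x,0)=0$; $g_M$ is an $\mathbb{R}^d$-valued homogeneous polynomial of degree $M$ with $g_M(x,0)=0$ and $D_yg_M(x,0)=0$; and $f_{\ge N+1}$, $g_{\ge M+1}$ are analytic on $U$ and vanish at the origin together with their derivatives up to order $N$ and $M$, respectively. Write $X=(X^x,X^y)$. Then: (1) The invariance equation $$X^y(x,\varphi(x))=\varphi'(x)\,X^x(x,\varphi(x))$$ has a real-analytic solution $\varphi$ tangent to the $x$-axis at the origin, i.e. $\varphi(0)=0$ and $\varphi'(0)=0$.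 More precisely, $X$ extends holomorphically to a neighbourhood of the origin in $\mathbb{C}\times\mathbb{C}^d$, and for some $\rho>0$ there is a holomorphic $\varphi: B_\rho=\{x\in\mathbb{C}:|x|<\rho\}\to\mathbb{C}^d$, with real values at real points and $\varphi(0)=\varphi'(0)=0$, which satisfies the equation on $B_\rho$ for the extended field, and on $(-\rho,\rho)$ for $X$ itself (the graph lying in the respective domains). (2) Consequently, if a map $F=(F^x,F^y)$ on an open neighbourhood of the origin is the time-$1$ map of $\dot\xi=X(\xi)$, then there is a real-analytic $\Phi$ on an interval $(-\rho,\rho)$, $\rho>0$, with $\Phi(0)=0$ and $\Phi'(0)=0$, which satisfies the graph invariance equation $$F^y(x,\Phi(x))=\Phi\bigl(F^x(x,\Phi(x))\bigr)$$ for all real $x$ sufficiently close to $0$ (with $(x,\Phi(x))$ in the domain of $F$ and $|F^x(x,\Phi(x))|<\rho$). -/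

import Mathlib

open Metric

/-- The germ condition "`f` has order at least `k`" at the origin: `f` and its derivatives
vanish there up to order `k - 1`. -/
def HasOrderGE {E G : Type*} [NormedAddCommGroup E] [NormedSpace ℝ E]
    [NormedAddCommGroup G] [NormedSpace ℝ G] (f : E → G) (k : ℕ) : Prop :=
  ∀ j : ℕ, j < k → iteratedFDeriv ℝ j f 0 = 0

/-- `X` is, on the open set `U ∋ 0` of `ℝ × ℝ^d`, a real analytic vector field of the form
`X(x, y) = (-a x^N + f_N + f_{≥N+1}, x^{M-1} B₁ y + g_M + g_{≥M+1})`, where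
`f_N`, `g_M` are homogeneous polynomials (in the `d + 1` variables `(x, y)`, the variable `0`
being `x` and the variable `j.succ` being `y_j`) with `f_N(x, 0) = 0`, `g_M(x, 0) = 0`,
`D_y g_M(x, 0) = 0`, and the analytic remainders have order `N + 1` and `M + 1`. -/
def IsParabolicField {d : ℕ} (N M : ℕ) (a : ℝ) (B₁ : Matrix (Fin d) (Fin d) ℝ)
    (U : Set (ℝ × (Fin d → ℝ))) (X : ℝ × (Fin d → ℝ) → ℝ × (Fin d → ℝ)) : Prop :=
  IsOpen U ∧ 0 ∈ U ∧
  ∃ (fN : MvPolynomial (Fin (d + 1)) ℝ) (gM : Fin d → MvPolynomial (Fin (d + 1)) ℝ)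
    (fR : ℝ × (Fin d → ℝ) → ℝ) (gR : ℝ × (Fin d → ℝ) → (Fin d → ℝ)),
    fN.IsHomogeneous N ∧
    (∀ x : ℝ, MvPolynomial.eval (Fin.cons x 0) fN = 0) ∧
    (∀ i, (gM i).IsHomogeneous M) ∧
    (∀ i, ∀ x : ℝ, MvPolynomial.eval (Fin.cons x 0) (gM i) = 0) ∧
    (∀ (i j : Fin d) (x : ℝ),
      MvPolynomial.eval (Fin.cons x 0) (MvPolynomial.pderiv j.succ (gM i)) = 0) ∧
    AnalyticOnNhd ℝ fR U ∧ HasOrderGE fR (N + 1) ∧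
    AnalyticOnNhd ℝ gR U ∧ HasOrderGE gR (M + 1) ∧
    ∀ (x : ℝ) (y : Fin d → ℝ), (x, y) ∈ U →
      X (x, y) =
        (-a * x ^ N + MvPolynomial.eval (Fin.cons x y) fN + fR (x, y),
         x ^ (M - 1) • B₁.mulVec y +
           (fun i => MvPolynomial.eval (Fin.cons x y) (gM i)) + gR (x, y))

/-- The conditions on `B₁`: invertible if `M < N`; all `B₁ + l a Id`, `l ≥ 2`, invertible if
`M = N`; none if `M > N`. -/
def IsNonresonant {d : ℕ} (N M : ℕ) (a : ℝ) (B₁ : Matrix (Fin d) (Fin d) ℝ) : Prop :=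
  (M < N → IsUnit B₁) ∧
  (M = N → ∀ l : ℕ, 2 ≤ l →
    IsUnit (B₁ + ((l : ℝ) * a) • (1 : Matrix (Fin d) (Fin d) ℝ)))

/-- The inclusion `ℝ^d → ℂ^d`. -/
def complexify {d : ℕ} (y : Fin d → ℝ) : Fin d → ℂ := fun i => (y i : ℂ)

/-- `Xc` is a holomorphic extension of the vector field `X` (given on `U`) to the open
neighbourhood `V` of the origin of `ℂ × ℂ^d`. -/
def IsHolomorphicExtension {d : ℕ} (U : Set (ℝ × (Fin d → ℝ)))
    (X : ℝ × (Fin d → ℝ) → ℝ × (Fin d → ℝ)) (V : Set (ℂ × (Fin d → ℂ)))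
    (Xc : ℂ × (Fin d → ℂ) → ℂ × (Fin d → ℂ)) : Prop :=
  IsOpen V ∧ 0 ∈ V ∧ AnalyticOnNhd ℂ Xc V ∧
  ∀ (x : ℝ) (y : Fin d → ℝ), (x, y) ∈ U → ((x : ℂ), complexify y) ∈ V →
    Xc ((x : ℂ), complexify y) = (((X (x, y)).1 : ℂ), complexify (X (x, y)).2)

/-- The graph of `φ` over `D` is contained in the domain `U` of `X` and `φ` satisfies the
invariance equation `X^y(x, φ(x)) = φ'(x) X^x(x, φ(x))` on `D`. -/
def SolvesInvariance {𝕜 : Type*} [NontriviallyNormedField 𝕜] {d : ℕ}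
    (U : Set (𝕜 × (Fin d → 𝕜))) (X : 𝕜 × (Fin d → 𝕜) → 𝕜 × (Fin d → 𝕜))
    (D : Set 𝕜) (φ : 𝕜 → (Fin d → 𝕜)) : Prop :=
  ∀ x ∈ D, (x, φ x) ∈ U ∧ (X (x, φ x)).2 = (X (x, φ x)).1 • deriv φ x

/-- `F` is, on the open neighbourhood `W` of the origin, the time `1` map of the autonomous
vector field `X` on `U`: every `p ∈ W` has a trajectory in `U` on `[0, 1]`, going from `p`
to `F p`. -/
def IsTimeOneMap {d : ℕ} (U : Set (ℝ × (Fin d → ℝ)))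
    (X : ℝ × (Fin d → ℝ) → ℝ × (Fin d → ℝ)) (W : Set (ℝ × (Fin d → ℝ)))
    (F : ℝ × (Fin d → ℝ) → ℝ × (Fin d → ℝ)) : Prop :=
  IsOpen W ∧ 0 ∈ W ∧
  ∀ p ∈ W, ∃ γ : ℝ → ℝ × (Fin d → ℝ), γ 0 = p ∧ γ 1 = F p ∧
    ∀ t ∈ Set.Icc (0 : ℝ) 1,
      γ t ∈ U ∧ HasDerivWithinAt γ (X (γ t)) (Set.Icc (0 : ℝ) 1) t

/-! Blow up the origin by `y = x ψ`. Homogeneity and the orders of the remainders give `X^x = x^N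
den(x, ψ)` and `X^y = x^M num(x, ψ)`, with `den(0, 0) = -a ≠ 0` and `num(0, 0) = 0`. For `φ = x ψ`
the invariance equation follows from the singular equation `x ψ' = x^(M-N) num / den - ψ`. Its
linear part in `ψ` at the origin is `D = -1` if `M > N` and `D = -1 - a⁻¹ B₁` if `M = N`. Hence no
integer `k ≥ 1` is an eigenvalue of `D`: for `M = N` this is the invertibility of `B₁ + (k + 1) a
Id`. `briot_bouquet` then gives an analytic `ψ` with `ψ(0) = 0`, so that `φ` is tangent to the axis.

Briot–Bouquet is proved in the Banach algebra of absolutely summable power series, where the Euler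
operator minus `D` has a bounded inverse on series without constant term. After rescaling `x` to `ρ
x`, the equation becomes a fixed point problem, solvable for small `ρ` by local surjectivity of a
strictly differentiable map.

One tool, `AnalyticAt.exists_algExt`, evaluates a real analytic germ in a Banach algebra and
recovers it through characters. It is used in `C([0,1])` to divide by powers of `x`, in the Wiener
algebra to substitute series, and in `ℂ` to complexify. The complex equation follows from the real
one by the identity theorem. Invariance under the time-one map follows from a Grönwall estimate for
the distance of a trajectory to the graph. -/

open Filter Topology

/-! ### Analytic germs evaluated in commutative Banach algebras -/

/-- The extension of a real formal multilinear series to an algebra `A`, where the vectors of `E'`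
are seen as having the `A`-valued coordinates `ℓ i` along the vectors `e i` of `E`. -/
noncomputable def FormalMultilinearSeries.algExt {ι E : Type*} [Fintype ι]
    [NormedAddCommGroup E] [NormedSpace ℝ E]
    {𝕜 : Type*} [RCLike 𝕜] {A : Type*} [NormedCommRing A] [NormedAlgebra 𝕜 A]
    {E' : Type*} [NormedAddCommGroup E'] [NormedSpace 𝕜 E']
    (p : FormalMultilinearSeries ℝ E ℝ) (e : ι → E) (ℓ : ι → E' →L[𝕜] A) :
    FormalMultilinearSeries 𝕜 E' A := fun n =>
  ∑ i : Fin n → ι, ((p n fun k => e (i k) : ℝ) : 𝕜) •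
    (ContinuousMultilinearMap.mkPiAlgebraFin 𝕜 n A).compContinuousLinearMap fun k => ℓ (i k)

section
variable {ι E : Type*} [Fintype ι]
    [NormedAddCommGroup E] [NormedSpace ℝ E]
    {𝕜 : Type*} [RCLike 𝕜] {A : Type*} [NormedCommRing A] [NormedAlgebra 𝕜 A]
    {E' : Type*} [NormedAddCommGroup E'] [NormedSpace 𝕜 E']
    (p : FormalMultilinearSeries ℝ E ℝ) (e : ι → E) (ℓ : ι → E' →L[𝕜] A)

theorem FormalMultilinearSeries.algExt_apply (n : ℕ) (v : Fin n → E') :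
    p.algExt e ℓ n v = ∑ i : Fin n → ι, ((p n fun k => e (i k) : ℝ) : 𝕜) •
      ∏ k, ℓ (i k) (v k) := by
  simp [FormalMultilinearSeries.algExt, List.prod_ofFn]

/-- A character is multiplicative, so it turns each product of coordinates into a product of real
numbers; multilinearity of `p n` reassembles the sum. -/
theorem FormalMultilinearSeries.map_algExt (n : ℕ) (v : E') (χ : A →ₐ[𝕜] 𝕜) (r : ι → ℝ)
    (h : ∀ i, χ (ℓ i v) = (r i : 𝕜)) :
    χ (p.algExt e ℓ n fun _ => v) = ((p n fun _ => ∑ i, r i • e i : ℝ) : 𝕜) := by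
  classical
  rw [p.algExt_apply, ContinuousMultilinearMap.map_sum]
  simp only [map_sum, map_smul, map_prod, h, ContinuousMultilinearMap.map_smul_univ]
  push_cast
  refine Finset.sum_congr rfl fun i _ => ?_
  simp [mul_comm]

/-- There are `(card ι) ^ n` terms, each costing one factor `C` for the vector and one for the
coordinate form in every slot. The loss is geometric in `n`, which keeps the radius positive. -/
theorem FormalMultilinearSeries.norm_algExt_le [NormOneClass A] {C : ℝ} (hC : 0 ≤ C)
    (he : ∀ i, ‖e i‖ ≤ C) (hℓ : ∀ i, ‖ℓ i‖ ≤ C) (n : ℕ) :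
    ‖p.algExt e ℓ n‖ ≤ ‖p n‖ * (Fintype.card ι * (C * C)) ^ n := by
  have key : ∀ i : Fin n → ι, ‖((p n fun k => e (i k) : ℝ) : 𝕜) •
      (ContinuousMultilinearMap.mkPiAlgebraFin 𝕜 n A).compContinuousLinearMap fun k => ℓ (i k)‖
      ≤ ‖p n‖ * (C * C) ^ n := fun i => by
    rw [norm_smul, mul_pow, ← mul_assoc]
    gcongr
    · rw [RCLike.norm_ofReal, ← Real.norm_eq_abs]
      refine ((p n).le_opNorm _).trans ?_
      gcongr
      refine (Finset.prod_le_prod (fun _ _ => norm_nonneg _) fun k _ => he (i k)).trans (by simp)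
    · refine (ContinuousMultilinearMap.norm_compContinuousLinearMap_le _ _).trans ?_
      rw [ContinuousMultilinearMap.norm_mkPiAlgebraFin, one_mul]
      refine (Finset.prod_le_prod (fun _ _ => norm_nonneg _) fun k _ => hℓ (i k)).trans (by simp)
  refine (norm_sum_le_of_le _ fun i _ => key i).trans (le_of_eq ?_)
  simp [mul_pow]
  ring

theorem FormalMultilinearSeries.radius_algExt_pos [NormOneClass A] (hp : 0 < p.radius) :
    0 < (p.algExt e ℓ).radius := by
  obtain ⟨r, hr0, hr⟩ := ENNReal.lt_iff_exists_nnreal_btwn.1 hp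
  obtain ⟨B, hB, hpB⟩ := p.norm_mul_pow_le_of_lt_radius hr
  obtain ⟨C, hC⟩ : ∃ C : NNReal, 0 < C ∧ (∀ i, ‖e i‖ ≤ C) ∧ ∀ i, ‖ℓ i‖ ≤ C := by
    refine ⟨1 + ∑ i, ‖e i‖₊ + ∑ i, ‖ℓ i‖₊, by positivity, fun i => ?_, fun i => ?_⟩
    · have := Finset.single_le_sum (f := fun i => ‖e i‖₊) (fun _ _ => zero_le) (Finset.mem_univ i)
      exact_mod_cast this.trans (by rw [add_assoc, add_left_comm]; exact le_self_add)
    · have := Finset.single_le_sum (f := fun i => ‖ℓ i‖₊) (fun _ _ => zero_le) (Finset.mem_univ i)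
      exact_mod_cast this.trans le_add_self
  -- The summand 1 keeps `K` positive when `ι` is empty.
  set K : NNReal := Fintype.card ι * (C * C) + 1 with hK
  have hK0 : 0 < K := by rw [hK]; positivity
  have hr0' : 0 < r := by exact_mod_cast hr0
  refine lt_of_lt_of_le (b := ((r / K : NNReal) : ENNReal))
    (ENNReal.coe_pos.2 (div_pos hr0' hK0))
    (FormalMultilinearSeries.le_radius_of_bound _ B fun n => ?_)
  refine le_trans ?_ (hpB n)
  refine (mul_le_mul_of_nonneg_right (p.norm_algExt_le e ℓ C.coe_nonneg hC.2.1 hC.2.2 n)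
    (by positivity)).trans ?_
  rw [mul_assoc, ← mul_pow]
  refine mul_le_mul_of_nonneg_left (pow_le_pow_left₀
    (mul_nonneg (by positivity) (NNReal.coe_nonneg _)) ?_ n) (norm_nonneg _)
  have : (Fintype.card ι * (C * C) : ℝ) ≤ K := by simp [hK]
  have hK0' : (K : ℝ) ≠ 0 := by exact_mod_cast hK0.ne'
  push_cast
  calc (Fintype.card ι * (C * C) : ℝ) * (r / K) ≤ K * (r / K) := by gcongr
    _ = r := by field_simp

/-- Extension of a real analytic germ to a commutative Banach algebra. -/
theorem AnalyticAt.exists_algExt [NormOneClass A] [CompleteSpace A] {f : E → ℝ}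
    (hf : AnalyticAt ℝ f 0) :
    ∃ (g : E' → A) (ε : ℝ), 0 < ε ∧ AnalyticOnNhd 𝕜 g (ball 0 ε) ∧
      g 0 = algebraMap 𝕜 A (f 0 : 𝕜) ∧
      HasStrictFDerivAt g (∑ i, ((fderiv ℝ f 0 (e i) : ℝ) : 𝕜) • ℓ i) 0 ∧
      ∀ v ∈ ball (0 : E') ε, ∀ χ : A →ₐ[𝕜] 𝕜, Continuous χ → ∀ r : ι → ℝ, ‖r‖ < ε →
        (∀ i, χ (ℓ i v) = (r i : 𝕜)) → χ (g v) = (f (∑ i, r i • e i) : 𝕜) := by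
  obtain ⟨p, R, hp⟩ := hf
  have hq := (p.algExt e ℓ).hasFPowerSeriesOnBall (p.radius_algExt_pos e ℓ hp.radius_pos)
  have hlim : Tendsto (fun r : ι → ℝ => ∑ i, r i • e i) (𝓝 0) (𝓝 0) := by
    have : Continuous (fun r : ι → ℝ => ∑ i, r i • e i) := by fun_prop
    simpa using this.tendsto 0
  obtain ⟨ε₁, hε₁, h₁⟩ := Metric.eventually_nhds_iff_ball.1
    (hlim.eventually (Metric.eball_mem_nhds (0 : E) hp.r_pos))
  obtain ⟨ε₂, hε₂, h₂⟩ := Metric.eventually_nhds_iff_ball.1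
    (Metric.eball_mem_nhds (0 : E') hq.r_pos)
  refine ⟨(p.algExt e ℓ).sum, min ε₁ ε₂, lt_min hε₁ hε₂, fun v hv => ?_, ?_, ?_, ?_⟩
  · exact hq.analyticAt_of_mem (h₂ v (ball_subset_ball (min_le_right _ _) hv))
  · rw [← hq.coeff_zero fun _ => 0, p.algExt_apply, ← hp.coeff_zero fun _ => 0]
    rw [Fintype.sum_unique, Algebra.algebraMap_eq_smul_one, Fin.prod_univ_zero,
      Subsingleton.elim (fun k : Fin 0 => e ((default : Fin 0 → ι) k)) fun _ => 0]
  · have h := hq.hasFPowerSeriesAt.hasStrictFDerivAt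
    have he : continuousMultilinearCurryFin1 𝕜 E' A (p.algExt e ℓ 1) =
        ∑ i, ((fderiv ℝ f 0 (e i) : ℝ) : 𝕜) • ℓ i := by
      ext v
      rw [hp.hasFPowerSeriesAt.hasFDerivAt.fderiv]
      simp only [continuousMultilinearCurryFin1_apply, p.algExt_apply,
        Finset.univ_unique, Finset.prod_singleton, FunLike.coe_sum, Finset.sum_apply,
        smul_apply]
      refine Fintype.sum_equiv (Equiv.funUnique (Fin 1) ι) _ _ fun i => ?_
      have h1 : (fun k => e (i k)) = fun _ : Fin 1 => e (i 0) :=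
        funext fun k => by rw [Subsingleton.elim k 0]
      have h2 : (Fin.snoc 0 (e (i 0)) : Fin 1 → E) = fun _ : Fin 1 => e (i 0) :=
        funext fun k => by
          obtain rfl : k = Fin.last 0 := Fin.ext (by simp)
          exact Fin.snoc_last _ _
      simp only [h1, Equiv.funUnique_apply]
      erw [h2]
      rfl
    rwa [he] at h
  · intro v hv χ hχ r hr h
    -- Both series converge, and the continuous character `χ` matches them term by term.
    have h3 := (hq.hasSum (h₂ v (ball_subset_ball (min_le_right _ _) hv))).map χ hχ
    have h4 := hp.hasSum (h₁ r (by simpa using hr.trans_le (min_le_left _ _)))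
    have h5 := h4.map (algebraMap ℝ 𝕜) (by simpa using RCLike.continuous_ofReal)
    simp only [zero_add] at h3 h5
    refine h3.unique ?_
    convert h5 using 1
    ext n
    simpa using p.map_algExt e ℓ n v χ r h

end

/-! ### Division of analytic germs by powers of the first coordinate -/

/-- The standard basis of `𝕜 × 𝕜 ^ d`. -/
def coordVec (𝕜 : Type*) [NontriviallyNormedField 𝕜] (d : ℕ) :
    Option (Fin d) → 𝕜 × (Fin d → 𝕜)
  | none => (1, 0)
  | some j => (0, Pi.single j 1)

theorem sum_smul_coordVec {𝕜 : Type*} [NontriviallyNormedField 𝕜] {d : ℕ}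
    (r : Option (Fin d) → 𝕜) :
    ∑ i, r i • coordVec 𝕜 d i = (r none, fun j => r (some j)) := by
  rw [Fintype.sum_option]
  ext k
  · simp [coordVec, Prod.fst_sum]
  · simp [coordVec, Prod.snd_sum, Finset.sum_apply, Pi.single_apply]

theorem norm_option_elim_lt {d : ℕ} {ε x : ℝ} {y : Fin d → ℝ} (h : ‖(x, y)‖ < ε) :
    ‖(fun i : Option (Fin d) => i.elim x y)‖ < ε := by
  have hε : 0 < ε := (norm_nonneg _).trans_lt h
  rw [pi_norm_lt_iff hε]
  rw [Prod.norm_def, sup_lt_iff] at h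
  rintro (_ | j)
  · exact h.1
  · exact (norm_le_pi_norm y j).trans_lt h.2

/-- Integration over the unit interval. -/
noncomputable def integralUnitInterval : C(unitInterval, ℝ) →L[ℝ] ℝ :=
  have hi : ∀ u : C(unitInterval, ℝ), MeasureTheory.Integrable u := fun u =>
    u.continuous.integrable_of_hasCompactSupport (HasCompactSupport.of_compactSpace _)
  LinearMap.mkContinuous
    { toFun := fun u => ∫ t, u t
      map_add' := fun u v => MeasureTheory.integral_add (hi u) (hi v)
      map_smul' := fun c u => MeasureTheory.integral_const_mul c u } 1 fun u => by
    simpa using MeasureTheory.norm_integral_le_of_norm_le_const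
      (μ := (MeasureTheory.volume : MeasureTheory.Measure unitInterval))
      (Eventually.of_forall fun t => u.norm_coe_le_norm t)

theorem integralUnitInterval_of_eq {u : C(unitInterval, ℝ)} {f : ℝ → ℝ}
    (h : ∀ t : unitInterval, u t = f t) : integralUnitInterval u = ∫ t in (0 : ℝ)..1, f t := by
  change ∫ t, u t = _
  simp only [h]
  rw [intervalIntegral.integral_of_le zero_le_one, ← MeasureTheory.integral_Icc_eq_integral_Ioc]
  exact MeasureTheory.integral_subtype_comap measurableSet_Icc f

/-- An analytic germ vanishing on `{0} × ℝ ^ d` is divisible by the first coordinate. -/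
theorem AnalyticAt.exists_eq_fst_mul {d : ℕ} {h : ℝ × (Fin d → ℝ) → ℝ} (hh : AnalyticAt ℝ h 0)
    (h0 : ∀ᶠ ψ in 𝓝 (0 : Fin d → ℝ), h (0, ψ) = 0) :
    ∃ h₁ : ℝ × (Fin d → ℝ) → ℝ, AnalyticAt ℝ h₁ 0 ∧ ∀ᶠ v in 𝓝 0, h v = v.1 * h₁ v := by
  set k : ℝ × (Fin d → ℝ) → ℝ := fun v => fderiv ℝ h v (1, 0) with hk
  have hk' : AnalyticAt ℝ k 0 :=
    ((ContinuousLinearMap.apply ℝ ℝ ((1, 0) : ℝ × (Fin d → ℝ))).analyticAt _).comp hh.fderiv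
  -- The coordinates `x τ` and `ψ_j 1` in `C([0,1])` encode the segment `t ↦ (t x, ψ)`, and
  -- evaluation at `t` is a character. So `v ↦ (t ↦ k (t x, ψ))` is analytic, and `h = x ∫ k (t x,
  -- ψ) dt` is Hadamard's formula.
  let τ : C(unitInterval, ℝ) := ⟨Subtype.val, continuous_subtype_val⟩
  let ℓ : Option (Fin d) → ℝ × (Fin d → ℝ) →L[ℝ] C(unitInterval, ℝ) := fun i =>
    i.elim ((ContinuousLinearMap.fst ℝ ℝ (Fin d → ℝ)).smulRight τ) fun j =>
      ((ContinuousLinearMap.proj j).comp (ContinuousLinearMap.snd ℝ ℝ (Fin d → ℝ))).smulRight 1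
  obtain ⟨g, ε, hε, hg, -, -, hgk⟩ := hk'.exists_algExt (coordVec ℝ d) ℓ
  refine ⟨fun v => integralUnitInterval (g v),
    (integralUnitInterval.analyticAt _).comp (hg 0 (mem_ball_self hε)), ?_⟩
  obtain ⟨δ, hδ, hball⟩ := Metric.eventually_nhds_iff_ball.1
    (hh.eventually_analyticAt.and hk'.eventually_analyticAt)
  have h0' : ∀ᶠ v in 𝓝 (0 : ℝ × (Fin d → ℝ)), h (0, v.2) = 0 :=
    (continuous_snd.tendsto' (0 : ℝ × (Fin d → ℝ)) 0 rfl).eventually h0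
  filter_upwards [ball_mem_nhds 0 hε, ball_mem_nhds 0 hδ, h0'] with v hvε hvδ hv0
  have hle : ∀ t ∈ Set.Icc (0 : ℝ) 1, ‖(t * v.1, v.2)‖ ≤ ‖v‖ := fun t ht => by
    rw [Prod.norm_def, Prod.norm_def]
    refine max_le_max ?_ le_rfl
    rw [norm_mul]
    exact mul_le_of_le_one_left (norm_nonneg _) (by simpa [abs_of_nonneg ht.1] using ht.2)
  rw [mem_ball_zero_iff] at hvε hvδ
  have hval : ∀ t : unitInterval, g v t = k (t * v.1, v.2) := fun t => by
    have := hgk v (by simpa using hvε) (ContinuousMap.evalAlgHom ℝ ℝ t)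
      (continuous_eval_const t) (fun i => i.elim (t * v.1) v.2)
      (norm_option_elim_lt ((hle t t.2).trans_lt hvε)) (by
        rintro (_ | j)
        · simp [ℓ, τ, mul_comm]
        · simp [ℓ])
    rw [sum_smul_coordVec] at this
    simpa using this
  rw [integralUnitInterval_of_eq (f := fun t => k (t * v.1, v.2)) hval, ← intervalIntegral.integral_const_mul,
    intervalIntegral.integral_eq_sub_of_hasDerivAt (f := fun t => h (t * v.1, v.2))]
  · simp [hv0]
  · intro t ht
    rw [Set.uIcc_of_le zero_le_one] at ht
    have h1 := (hball (t * v.1, v.2) (mem_ball_zero_iff.2 ((hle t ht).trans_lt hvδ))).1.differentiableAt.hasFDerivAt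
    have h2 : HasDerivAt (fun t => (t * v.1, v.2)) (v.1, (0 : Fin d → ℝ)) t := by
      simpa using ((hasDerivAt_id t).mul_const v.1).prodMk (hasDerivAt_const t v.2)
    have h3 := h1.comp_hasDerivAt t h2
    have h4 : v.1 * k (t * v.1, v.2) = fderiv ℝ h (t * v.1, v.2) (v.1, 0) := by
      rw [hk, ← smul_eq_mul, ← map_smul]
      simp
    rw [h4]
    exact h3
  · refine ContinuousOn.intervalIntegrable fun t ht => ?_
    rw [Set.uIcc_of_le zero_le_one] at ht
    have h1 := (hball (t * v.1, v.2) (mem_ball_zero_iff.2 ((hle t ht).trans_lt hvδ))).2.continuousAt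
    have h2 : ContinuousAt (fun t => k (t * v.1, v.2)) t :=
      ContinuousAt.comp (f := fun t : ℝ => (t * v.1, v.2)) h1 (by fun_prop)
    exact (continuousAt_const.mul h2).continuousWithinAt

/-- An analytic germ which is `O(x ^ k)` is divisible by `x ^ k`. -/
theorem AnalyticAt.exists_eq_fst_pow_mul {d : ℕ} (k : ℕ) {h : ℝ × (Fin d → ℝ) → ℝ}
    (hh : AnalyticAt ℝ h 0) {C : ℝ} (hC : ∀ᶠ v in 𝓝 0, |h v| ≤ C * |v.1| ^ k) :
    ∃ h₁ : ℝ × (Fin d → ℝ) → ℝ, AnalyticAt ℝ h₁ 0 ∧ ∀ᶠ v in 𝓝 0, h v = v.1 ^ k * h₁ v := by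
  induction k generalizing h with
  | zero => exact ⟨h, hh, by simp⟩
  | succ k ih =>
    have hi : Tendsto (fun ψ : Fin d → ℝ => ((0 : ℝ), ψ)) (𝓝 0) (𝓝 0) :=
      Continuous.tendsto' (by fun_prop) _ _ rfl
    obtain ⟨h₁, hh₁, heq⟩ := hh.exists_eq_fst_mul ((hi.eventually hC).mono fun ψ hψ => by
      simpa using hψ)
    -- Where `x ≠ 0`, divide the bound by `|x|`. Such points are dense, so the bound extends to `x =
    -- 0` by continuity.
    have hC₁ : ∀ᶠ v in 𝓝 (0 : ℝ × (Fin d → ℝ)), |h₁ v| ≤ C * |v.1| ^ k := by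
      filter_upwards [(heq.and hC).eventually_nhds, hh₁.eventually_analyticAt] with v hv hav
      have hne : ∃ᶠ w in 𝓝 v, w.1 ≠ 0 := by
        have h1 : Tendsto (fun t : ℝ => (v.1 + t, v.2)) (𝓝[≠] 0) (𝓝 v) :=
          (Continuous.tendsto' (by fun_prop) _ _ (by simp)).mono_left nhdsWithin_le_nhds
        refine h1.frequently (Eventually.frequently ?_)
        by_cases hv1 : v.1 = 0
        · filter_upwards [self_mem_nhdsWithin] with t ht
          simpa [hv1] using ht
        · have : ContinuousAt (fun t : ℝ => v.1 + t) 0 := by fun_prop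
          exact (this.eventually_ne (by simpa using hv1)).filter_mono nhdsWithin_le_nhds
      have hcont : ContinuousAt (fun w : ℝ × (Fin d → ℝ) => C * |w.1| ^ k - |h₁ w|) v :=
        (by fun_prop : ContinuousAt (fun w : ℝ × (Fin d → ℝ) => C * |w.1| ^ k) v).sub
          hav.continuousAt.abs
      by_contra hlt
      have hlt' := hcont.eventually_lt continuousAt_const (sub_neg.2 (not_le.1 hlt))
      obtain ⟨w, hw, ⟨hw1, hw2⟩, hw3⟩ := (hne.and_eventually (hv.and hlt')).exists
      rw [hw1, abs_mul, pow_succ, ← mul_assoc, mul_comm |w.1|] at hw2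
      have := le_of_mul_le_mul_right hw2 (abs_pos.2 hw)
      linarith
    obtain ⟨h₂, hh₂, heq₂⟩ := ih hh₁ hC₁
    refine ⟨h₂, hh₂, ?_⟩
    filter_upwards [heq, heq₂] with v h1 h2
    rw [h1, h2, pow_succ]
    ring

/-! ### The Wiener algebra of absolutely summable power series -/

/-- The Wiener algebra `ℓ¹(ℕ)` of real power series converging absolutely on the closed unit
disc, with the Cauchy product. -/
def Wiener : Type := lp (fun _ : ℕ => ℝ) 1

namespace Wiener

noncomputable instance : NormedAddCommGroup Wiener :=
  inferInstanceAs (NormedAddCommGroup (lp (fun _ : ℕ => ℝ) 1))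
noncomputable instance : NormedSpace ℝ Wiener :=
  inferInstanceAs (NormedSpace ℝ (lp (fun _ : ℕ => ℝ) 1))
instance : CompleteSpace Wiener := inferInstanceAs (CompleteSpace (lp (fun _ : ℕ => ℝ) 1))

/-- The coefficients of an element of the Wiener algebra. -/
def coeff (u : Wiener) : ℕ → ℝ := u.1

@[ext] theorem ext {u v : Wiener} (h : ∀ n, u.coeff n = v.coeff n) : u = v :=
  Subtype.ext (funext h)

@[simp] theorem coeff_add (u v : Wiener) (n : ℕ) : (u + v).coeff n = u.coeff n + v.coeff n := rfl
@[simp] theorem coeff_smul (c : ℝ) (u : Wiener) (n : ℕ) : (c • u).coeff n = c * u.coeff n := rfl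
@[simp] theorem coeff_zero (n : ℕ) : (0 : Wiener).coeff n = 0 := rfl

theorem memℓp_one_iff {f : ℕ → ℝ} : Memℓp f 1 ↔ Summable fun n => ‖f n‖ := by
  rw [memℓp_gen_iff (by simp)]
  simp

theorem summable_norm_coeff (u : Wiener) : Summable fun n => ‖u.coeff n‖ :=
  memℓp_one_iff.1 u.2

theorem norm_eq_tsum (u : Wiener) : ‖u‖ = ∑' n, ‖u.coeff n‖ := by
  have := lp.norm_eq_tsum_rpow (p := 1) (by simp) u
  simp only [ENNReal.toReal_one, Real.rpow_one, div_one] at this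
  exact this

/-- The element of the Wiener algebra with given coefficients. -/
def mk (f : ℕ → ℝ) (hf : Summable fun n => ‖f n‖) : Wiener := ⟨f, memℓp_one_iff.2 hf⟩

@[simp] theorem coeff_mk (f : ℕ → ℝ) (hf) (n : ℕ) : (mk f hf).coeff n = f n := rfl

theorem norm_coeff_le (u : Wiener) (n : ℕ) : ‖u.coeff n‖ ≤ ‖u‖ := by
  rw [norm_eq_tsum]
  exact u.summable_norm_coeff.le_tsum n fun _ _ => norm_nonneg _

/-- The Cauchy product. -/
noncomputable instance : Mul Wiener :=
  ⟨fun u v => mk (fun n => ∑ kl ∈ Finset.HasAntidiagonal.antidiagonal n, u.coeff kl.1 * v.coeff kl.2)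
    (summable_norm_sum_mul_antidiagonal_of_summable_norm u.summable_norm_coeff
      v.summable_norm_coeff)⟩

theorem coeff_mul (u v : Wiener) (n : ℕ) :
    (u * v).coeff n = ∑ kl ∈ Finset.HasAntidiagonal.antidiagonal n, u.coeff kl.1 * v.coeff kl.2 := rfl

/-- The monomial of degree `m`. -/
noncomputable def monomial (m : ℕ) : Wiener :=
  mk (Pi.single m 1) (summable_of_ne_finset_zero (s := {m}) fun b hb => by
    simp [Pi.single_eq_of_ne (by simpa using hb : b ≠ m)])

noncomputable instance : One Wiener := ⟨monomial 0⟩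

theorem coeff_one (n : ℕ) : (1 : Wiener).coeff n = (Pi.single 0 1 : ℕ → ℝ) n := rfl

/-- Through this injection the ring axioms involving products are inherited from formal power
series. -/
theorem powerSeries_mk_injective :
    Function.Injective fun u : Wiener => PowerSeries.mk u.coeff := fun u v h =>
  Wiener.ext fun n => by simpa using congrArg (PowerSeries.coeff n) h

theorem powerSeries_mk_mul (u v : Wiener) :
    PowerSeries.mk (u * v).coeff = PowerSeries.mk u.coeff * PowerSeries.mk v.coeff := by
  ext n
  simp [PowerSeries.coeff_mul, coeff_mul]

theorem powerSeries_mk_add (u v : Wiener) :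
    PowerSeries.mk (u + v).coeff = PowerSeries.mk u.coeff + PowerSeries.mk v.coeff := by
  ext n
  simp

theorem powerSeries_mk_one : PowerSeries.mk (1 : Wiener).coeff = 1 := by
  ext n
  simp [PowerSeries.coeff_one, coeff_one, Pi.single_apply]

noncomputable instance : CommRing Wiener :=
  { (inferInstance : AddCommGroup Wiener) with
    mul := (· * ·)
    one := 1
    left_distrib := fun u v w => powerSeries_mk_injective <| by
      simp only [powerSeries_mk_mul, powerSeries_mk_add, mul_add]
    right_distrib := fun u v w => powerSeries_mk_injective <| by
      simp only [powerSeries_mk_mul, powerSeries_mk_add, add_mul]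
    zero_mul := fun u => by ext n; simp [coeff_mul]
    mul_zero := fun u => by ext n; simp [coeff_mul]
    mul_assoc := fun u v w => powerSeries_mk_injective <| by
      simp only [powerSeries_mk_mul, mul_assoc]
    one_mul := fun u => powerSeries_mk_injective <| by
      simp only [powerSeries_mk_mul, powerSeries_mk_one, one_mul]
    mul_one := fun u => powerSeries_mk_injective <| by
      simp only [powerSeries_mk_mul, powerSeries_mk_one, mul_one]
    mul_comm := fun u v => powerSeries_mk_injective <| by
      simp only [powerSeries_mk_mul, mul_comm] }

noncomputable instance : NormedCommRing Wiener :=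
  { (inferInstance : NormedAddCommGroup Wiener), (inferInstance : CommRing Wiener) with
    norm_mul_le := fun u v => by
      have hu := u.summable_norm_coeff
      have hv := v.summable_norm_coeff
      have hu' : Summable fun n => ‖‖u.coeff n‖‖ := by simpa using hu
      have hv' : Summable fun n => ‖‖v.coeff n‖‖ := by simpa using hv
      rw [norm_eq_tsum, norm_eq_tsum, norm_eq_tsum,
        tsum_mul_tsum_eq_tsum_sum_antidiagonal_of_summable_norm hu' hv']
      refine Summable.tsum_le_tsum (fun n => ?_) (u * v).summable_norm_coeff
        (summable_norm_sum_mul_antidiagonal_of_summable_norm hu' hv').of_norm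
      rw [coeff_mul]
      exact norm_sum_le_of_le _ fun _ _ => norm_mul_le _ _ }

noncomputable instance : NormedAlgebra ℝ Wiener :=
  { Algebra.ofModule
      (fun c u v => by
        ext n
        simp only [coeff_mul, coeff_smul, Finset.mul_sum, mul_assoc])
      (fun c u v => by
        ext n
        simp only [coeff_mul, coeff_smul, Finset.mul_sum, mul_left_comm]) with
    norm_smul_le := fun c u => norm_smul_le c u }

instance : NormOneClass Wiener := ⟨by
  rw [norm_eq_tsum, tsum_eq_single 0 fun n hn => by simp [coeff_one, hn]]
  simp [coeff_one]⟩

theorem summable_norm_eval (u : Wiener) {x : ℝ} (hx : |x| ≤ 1) :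
    Summable fun n => ‖u.coeff n * x ^ n‖ :=
  u.summable_norm_coeff.of_nonneg_of_le (fun _ => norm_nonneg _) fun n => by
    rw [norm_mul, norm_pow]
    exact mul_le_of_le_one_right (norm_nonneg _) (pow_le_one₀ (norm_nonneg _) hx)

/-- The value at `x` of a power series in the Wiener algebra. -/
noncomputable def evalAt (u : Wiener) (x : ℝ) : ℝ := ∑' n, u.coeff n * x ^ n

/-- Contractivity makes evaluation a continuous character, and keeps the values of a small series in
the small ball where the germ is controlled. -/
theorem norm_evalAt_le (u : Wiener) {x : ℝ} (hx : |x| ≤ 1) : ‖u.evalAt x‖ ≤ ‖u‖ := by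
  rw [norm_eq_tsum]
  refine (norm_tsum_le_tsum_norm (u.summable_norm_eval hx)).trans
    ((u.summable_norm_eval hx).tsum_le_tsum (fun n => ?_) u.summable_norm_coeff)
  rw [norm_mul, norm_pow]
  exact mul_le_of_le_one_right (norm_nonneg _) (pow_le_one₀ (norm_nonneg _) hx)

theorem evalAt_zero (u : Wiener) : u.evalAt 0 = u.coeff 0 := by
  rw [evalAt, tsum_eq_single 0 fun n hn => by simp [hn]]
  simp

theorem evalAt_monomial (m : ℕ) (x : ℝ) : (monomial m).evalAt x = x ^ m := by
  rw [evalAt, tsum_eq_single m fun n hn => by simp [monomial, hn]]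
  simp [monomial]

theorem evalAt_add (u v : Wiener) {x : ℝ} (hx : |x| ≤ 1) :
    (u + v).evalAt x = u.evalAt x + v.evalAt x := by
  rw [evalAt, evalAt, evalAt,
    ← (u.summable_norm_eval hx).of_norm.tsum_add (v.summable_norm_eval hx).of_norm]
  simp [add_mul]

theorem evalAt_smul (c : ℝ) (u : Wiener) (x : ℝ) : (c • u).evalAt x = c * u.evalAt x := by
  simp only [evalAt, coeff_smul, mul_assoc, tsum_mul_left]

theorem evalAt_mul (u v : Wiener) {x : ℝ} (hx : |x| ≤ 1) :
    (u * v).evalAt x = u.evalAt x * v.evalAt x := by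
  rw [evalAt, evalAt, evalAt, tsum_mul_tsum_eq_tsum_sum_antidiagonal_of_summable_norm
    (u.summable_norm_eval hx) (v.summable_norm_eval hx)]
  refine tsum_congr fun n => ?_
  rw [coeff_mul, Finset.sum_mul]
  refine Finset.sum_congr rfl fun kl hkl => ?_
  rw [← Finset.HasAntidiagonal.mem_antidiagonal.1 hkl, pow_add]
  ring

/-- Evaluation at a point of `[-1, 1]`, as a character of the Wiener algebra. -/
noncomputable def evalHom (x : ℝ) (hx : |x| ≤ 1) : Wiener →ₐ[ℝ] ℝ :=
  AlgHom.ofLinearMap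
    { toFun := fun u => u.evalAt x
      map_add' := fun u v => evalAt_add u v hx
      map_smul' := fun c u => evalAt_smul c u x }
    ((evalAt_monomial 0 x).trans (pow_zero x)) (fun u v => evalAt_mul u v hx)

@[simp] theorem evalHom_apply (x : ℝ) (hx : |x| ≤ 1) (u : Wiener) :
    evalHom x hx u = u.evalAt x := rfl

theorem continuous_evalHom (x : ℝ) (hx : |x| ≤ 1) : Continuous (evalHom x hx) :=
  AddMonoidHomClass.continuous_of_bound (evalHom x hx) 1 fun u => by
    simpa using norm_evalAt_le u hx

theorem analyticAt_evalAt (u : Wiener) : AnalyticAt ℝ u.evalAt 0 := by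
  have h : 0 < (FormalMultilinearSeries.ofScalars ℝ u.coeff).radius := by
    refine lt_of_lt_of_le (b := ((1 : NNReal) : ENNReal)) (by simp)
      (FormalMultilinearSeries.le_radius_of_bound _ ‖u‖ fun n => ?_)
    simpa using u.norm_coeff_le n
  have h2 := (FormalMultilinearSeries.hasFPowerSeriesOnBall _ h).analyticAt
  have h3 : (FormalMultilinearSeries.ofScalars ℝ u.coeff).sum = u.evalAt := by
    funext x
    exact (FormalMultilinearSeries.ofScalars_sum_eq u.coeff x).trans (by simp [evalAt])
  rwa [h3] at h2

/-- If `n * uₙ` is summable, the Euler operator acts on coefficients. -/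
theorem hasDerivAt_evalAt {u w : Wiener} (h : ∀ n, w.coeff n = n * u.coeff n) {x : ℝ}
    (hx : |x| < 1) :
    ∃ y', HasDerivAt u.evalAt y' x ∧ x * y' = w.evalAt x := by
  -- Termwise differentiation: on the unit ball the `n`-th derivative is dominated by `‖w.coeff n‖`,
  -- which is summable.
  have key := hasDerivAt_tsum_of_isPreconnected (u := fun n => ‖w.coeff n‖)
    (g := fun n x => u.coeff n * x ^ n) (g' := fun n x => u.coeff n * (n * x ^ (n - 1)))
    (t := ball 0 1) (y₀ := 0) w.summable_norm_coeff isOpen_ball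
    (convex_ball _ _).isPreconnected
    (fun n y _ => (hasDerivAt_pow n y).const_mul _) (fun n y hy => ?_) (by simp)
    (u.summable_norm_eval (by simp)).of_norm (y := x) (by simpa using hx)
  · refine ⟨_, key, ?_⟩
    rw [← tsum_mul_left, evalAt]
    refine tsum_congr fun n => ?_
    rw [h]
    cases n with
    | zero => simp
    | succ n => simp [pow_succ]; ring
  · have hy' : ‖y‖ ≤ 1 := by simpa using (mem_ball.1 hy).le
    rw [h, ← mul_assoc, norm_mul, mul_comm (u.coeff n), norm_pow]
    exact mul_le_of_le_one_right (norm_nonneg _) (pow_le_one₀ (norm_nonneg _) hy')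

/-- Multiplication of the coefficients by a bounded sequence. -/
noncomputable def multiplier (c : ℕ → ℝ) (C : ℝ) (hc : ∀ n, ‖c n‖ ≤ C) : Wiener →L[ℝ] Wiener :=
  have hle : ∀ (u : Wiener) n, ‖c n * u.coeff n‖ ≤ C * ‖u.coeff n‖ := fun u n => by
    rw [norm_mul]
    exact mul_le_mul_of_nonneg_right (hc n) (norm_nonneg _)
  have hs : ∀ u : Wiener, Summable fun n => ‖c n * u.coeff n‖ := fun u =>
    (u.summable_norm_coeff.mul_left C).of_nonneg_of_le (fun _ => norm_nonneg _) (hle u)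
  LinearMap.mkContinuous
    { toFun := fun u => mk (fun n => c n * u.coeff n) (hs u)
      map_add' := fun u v => by ext n; simp [mul_add]
      map_smul' := fun r u => by ext n; simp [mul_left_comm] } C fun u => by
    rw [norm_eq_tsum, norm_eq_tsum, ← tsum_mul_left]
    exact (hs u).tsum_le_tsum (hle u) (u.summable_norm_coeff.mul_left C)

@[simp] theorem coeff_multiplier (c : ℕ → ℝ) (C : ℝ) (hc : ∀ n, ‖c n‖ ≤ C) (u : Wiener) (n : ℕ) :
    (multiplier c C hc u).coeff n = c n * u.coeff n := rfl

end Wiener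

/-! ### The Euler operator and the Briot–Bouquet theorem -/

theorem exists_pos_forall_le {ι : Type*} [Finite ι] {ε : ι → ℝ} (hε : ∀ i, 0 < ε i) :
    ∃ e > 0, ∀ i, e ≤ ε i := by
  obtain ⟨e, he, he0⟩ := ((eventually_all.2 fun i => Iic_mem_nhds (hε i)).filter_mono
    nhdsWithin_le_nhds |>.and (self_mem_nhdsWithin (s := Set.Ioi (0 : ℝ)))).exists
  exact ⟨e, he0, he⟩

namespace Wiener

/-- The coefficients, as linear forms. -/
noncomputable def coeffHom (n : ℕ) : Wiener →ₗ[ℝ] ℝ where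
  toFun u := u.coeff n
  map_add' _ _ := rfl
  map_smul' _ _ := rfl

theorem coeff_sum {ι : Type*} (s : Finset ι) (u : ι → Wiener) (n : ℕ) :
    (∑ i ∈ s, u i).coeff n = ∑ i ∈ s, (u i).coeff n :=
  map_sum (coeffHom n) u s

/-- A bounded solution operator of `x y' = D y + u` on power series, up to the constant term. -/
theorem exists_eulerInverse {d : ℕ} (D : (Fin d → ℝ) →L[ℝ] (Fin d → ℝ))
    (hD : ∀ k : ℕ, 1 ≤ k → IsUnit (algebraMap ℝ ((Fin d → ℝ) →L[ℝ] (Fin d → ℝ)) k - D)) :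
    ∃ T : (Fin d → Wiener) →L[ℝ] (Fin d → Wiener), ∀ u i,
      (T u i).coeff 0 = 0 ∧ ∀ k : ℕ, 1 ≤ k →
        k * (T u i).coeff k = D (fun j => (T u j).coeff k) i + (u i).coeff k := by
  set S : ℕ → (Fin d → ℝ) →L[ℝ] (Fin d → ℝ) := fun k => resolvent D (k : ℝ) with hS
  -- The resolvent tends to `0` at infinity, so its values at the integers are uniformly bounded.
  obtain ⟨C, hC⟩ : ∃ C, ∀ k, ‖S k‖ ≤ C := by
    have h1 : Tendsto S atTop (𝓝 0) := (spectrum.resolvent_tendsto_cobounded D).comp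
      (tendsto_natCast_atTop_cobounded)
    obtain ⟨C, hC⟩ := (Metric.isBounded_range_of_tendsto S h1).exists_norm_le
    exact ⟨C, fun k => hC _ ⟨k, rfl⟩⟩
  have hC0 : 0 ≤ C := (norm_nonneg _).trans (hC 0)
  -- Nothing is assumed on the resolvent at `k = 0`; the constant term is set to `0`.
  let c : Fin d → Fin d → ℕ → ℝ := fun i j k =>
    if k = 0 then 0 else S k (fun l => if j = l then 1 else 0) i
  have hc : ∀ i j k, ‖c i j k‖ ≤ C := fun i j k => by
    by_cases hk : k = 0
    · simpa [c, hk] using hC0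
    · simp only [c, hk, if_false]
      refine (norm_le_pi_norm _ i).trans (((S k).le_opNorm _).trans ?_)
      refine (mul_le_of_le_one_right (norm_nonneg _) ?_).trans (hC k)
      refine (pi_norm_le_iff_of_nonneg zero_le_one).2 fun l => ?_
      split_ifs <;> simp
  refine ⟨ContinuousLinearMap.pi fun i => ∑ j, (multiplier (c i j) C (hc i j)).comp
    (ContinuousLinearMap.proj j), fun u i => ⟨?_, fun k hk => ?_⟩⟩
  · simp [coeff_sum, c]
  · have hk0 : k ≠ 0 := by omega
    have key : (fun i => (∑ j, multiplier (c i j) C (hc i j) (u j)).coeff k) =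
        S k fun j => (u j).coeff k := by
      funext i
      rw [coeff_sum, ← ContinuousLinearMap.coe_coe, LinearMap.pi_apply_eq_sum_univ]
      simp [c, hk0, Finset.sum_apply, mul_comm]
    have hmul : (algebraMap ℝ ((Fin d → ℝ) →L[ℝ] (Fin d → ℝ)) k - D) * S k = 1 :=
      Ring.mul_inverse_cancel _ (hD k hk)
    have h2 := congrFun (DFunLike.congr_fun hmul fun j => (u j).coeff k) i
    have h3 := congrFun key i
    simp only [ContinuousLinearMap.coe_pi', FunLike.coe_sum, Finset.sum_apply,
      ContinuousLinearMap.comp_apply, ContinuousLinearMap.proj_apply]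
    rw [key, h3]
    simp at h2
    linarith

end Wiener

/-- **Briot–Bouquet theorem**: the singular equation `x ψ' = D ψ + R(x, ψ)`, with `R` analytic,
`R(0, 0) = 0`, `D_ψ R(0, 0) = 0`, has an analytic solution with `ψ(0) = 0` if no positive integer
is an eigenvalue of `D`. -/
theorem briot_bouquet {d : ℕ} (D : (Fin d → ℝ) →L[ℝ] (Fin d → ℝ))
    (hD : ∀ k : ℕ, 1 ≤ k → IsUnit (algebraMap ℝ ((Fin d → ℝ) →L[ℝ] (Fin d → ℝ)) k - D))
    {R : ℝ × (Fin d → ℝ) → (Fin d → ℝ)} (hR : AnalyticAt ℝ R 0) (hR0 : R 0 = 0)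
    (hR' : ∀ y, fderiv ℝ R 0 (0, y) = 0) :
    ∃ ψ : ℝ → (Fin d → ℝ), AnalyticAt ℝ ψ 0 ∧ ψ 0 = 0 ∧
      ∀ᶠ x in 𝓝 (0 : ℝ), x • deriv ψ x = D (ψ x) + R (x, ψ x) := by
  obtain ⟨T, hT⟩ := Wiener.exists_eulerInverse D hD
  -- The first coordinate `ρ` becomes the series `ρ x`: the unknown is `u(x) = ψ(ρ x)`, with `ρ` a
  -- small parameter.
  let ℓ : Option (Fin d) → ℝ × (Fin d → Wiener) →L[ℝ] Wiener := fun i =>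
    i.elim ((ContinuousLinearMap.fst ℝ ℝ (Fin d → Wiener)).smulRight (Wiener.monomial 1))
      fun j => (ContinuousLinearMap.proj j).comp (ContinuousLinearMap.snd ℝ ℝ (Fin d → Wiener))
  have hRi : ∀ i, AnalyticAt ℝ (fun v => R v i) 0 := fun i => analyticAt_pi_iff.1 hR i
  choose g ε hε _ hg0 hg' hgχ using fun i => (hRi i).exists_algExt (coordVec ℝ d) ℓ
  set G : ℝ × (Fin d → Wiener) → (Fin d → Wiener) := fun v i => g i v with hG
  have hG0 : G 0 = 0 := funext fun i => by simp [hG, hg0, hR0]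
  obtain ⟨G', hGG', hG'⟩ : ∃ G' : ℝ × (Fin d → Wiener) →L[ℝ] (Fin d → Wiener),
      HasStrictFDerivAt G G' 0 ∧ ∀ u, G' (0, u) = 0 := by
    refine ⟨_, hasStrictFDerivAt_pi.2 hg', fun u => funext fun i => ?_⟩
    have hz : ∀ j, fderiv ℝ (fun v => R v i) 0 (coordVec ℝ d (some j)) = 0 := fun j => by
      have h1 := (hasFDerivAt_pi'.1 hR.differentiableAt.hasFDerivAt) i
      rw [h1.fderiv]
      simp [coordVec, hR']
    simp [Fintype.sum_option, hz, ℓ]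
  -- A zero of the second component is a solution of `u = T (G (ρ, u))`. Since `G'` vanishes in the
  -- direction of `u`, the derivative is triangular with identity diagonal, hence surjective.
  have hΘ : HasStrictFDerivAt (fun v : ℝ × (Fin d → Wiener) => (v.1, v.2 - T (G v)))
      ((ContinuousLinearMap.fst ℝ ℝ (Fin d → Wiener)).prod
        (ContinuousLinearMap.snd ℝ ℝ (Fin d → Wiener) - T.comp G')) 0 :=
    hasStrictFDerivAt_fst.prodMk (hasStrictFDerivAt_snd.sub
      (T.hasStrictFDerivAt.comp (0 : ℝ × (Fin d → Wiener)) hGG'))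
  have hsurj := hΘ.map_nhds_eq_of_surj (LinearMap.range_eq_top.2 fun ⟨a, b⟩ =>
    ⟨(a, b + T (G' (a, 0))), by
      have h1 : G' (a, b + T (G' (a, 0))) = G' (a, 0) := by
        have := G'.map_add (a, 0) (0, b + T (G' (a, 0)))
        rwa [hG', Prod.mk_add_mk, add_zero, zero_add, add_zero] at this
      simp [h1]⟩)
  simp only [hG0, Prod.fst_zero, Prod.snd_zero, map_zero, sub_zero] at hsurj
  obtain ⟨e, he0, he⟩ := exists_pos_forall_le hε
  have himg := image_mem_map (m := fun v : ℝ × (Fin d → Wiener) => (v.1, v.2 - T (G v)))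
    (ball_mem_nhds (0 : ℝ × (Fin d → Wiener)) he0)
  rw [hsurj] at himg
  -- The image of a small ball is a neighbourhood of `0`, so it contains `(ρ, 0)` for some `ρ > 0`.
  have hpath : Tendsto (fun ρ : ℝ => (ρ, (0 : Fin d → Wiener))) (𝓝[>] 0) (𝓝 (0, 0)) :=
    (Continuous.tendsto' (by fun_prop) _ _ rfl).mono_left nhdsWithin_le_nhds
  obtain ⟨ρ, ⟨⟨ρ', u⟩, hv, hvρ⟩, hρ⟩ := ((hpath.eventually himg).and self_mem_nhdsWithin).exists
  simp only [Prod.mk.injEq] at hvρ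
  obtain ⟨rfl, hu⟩ := hvρ
  have hρ : 0 < ρ' := hρ
  rw [sub_eq_zero] at hu
  rw [mem_ball_zero_iff] at hv
  have hval : ∀ i x, |x| ≤ 1 →
      (g i (ρ', u)).evalAt x = R (ρ' * x, fun j => (u j).evalAt x) i := fun i x hx => by
    have := hgχ i (ρ', u) (by simpa using hv.trans_le (he i)) (Wiener.evalHom x hx)
      (Wiener.continuous_evalHom x hx) (fun l => l.elim (ρ' * x) fun j => (u j).evalAt x)
      (norm_option_elim_lt (lt_of_le_of_lt ?_ (hv.trans_le (he i)))) (by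
        rintro (_ | j)
        · simp [ℓ, Wiener.evalAt_monomial]
        · simp [ℓ])
    · rw [sum_smul_coordVec] at this
      simpa using this
    · rw [Prod.norm_def, Prod.norm_def]
      refine max_le_max ?_ ?_
      · rw [norm_mul]
        exact mul_le_of_le_one_right (norm_nonneg _) hx
      · exact (pi_norm_le_iff_of_nonneg (norm_nonneg _)).2 fun j =>
          (Wiener.norm_evalAt_le _ hx).trans (norm_le_pi_norm u j)
  have hu0 : ∀ i, (u i).coeff 0 = 0 := fun i => by
    rw [hu]
    exact (hT _ i).1
  -- `T` solves the equation only for `k ≥ 1`; in degree `0` it holds because `R 0 = 0`.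
  have hg00 : ∀ i, (g i (ρ', u)).coeff 0 = 0 := fun i => by
    rw [← Wiener.evalAt_zero, hval i 0 (by simp)]
    simp only [mul_zero, Wiener.evalAt_zero, hu0]
    exact congrFun hR0 i
  -- `z` is the right-hand side as an element of the algebra. Its coefficients are `n u_n`, so their
  -- summability, needed to differentiate `u`, is automatic.
  set z : Fin d → Wiener := fun i =>
    ∑ j, (D (fun l => if j = l then 1 else 0) i) • u j + g i (ρ', u) with hz
  have hDsum : ∀ (w : Fin d → ℝ) i,
      D w i = ∑ j, D (fun l => if j = l then 1 else 0) i * w j := fun w i => by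
    rw [← ContinuousLinearMap.coe_coe, LinearMap.pi_apply_eq_sum_univ]
    simp [Finset.sum_apply, mul_comm]
  have hzu : ∀ i n, (z i).coeff n = n * (u i).coeff n := fun i n => by
    have h1 : (z i).coeff n = D (fun j => (u j).coeff n) i + (g i (ρ', u)).coeff n := by
      rw [hDsum]
      simp only [hz, Wiener.coeff_add, Wiener.coeff_sum, Wiener.coeff_smul]
    rw [h1]
    rcases Nat.eq_zero_or_pos n with rfl | hn
    · have hD0 : D (fun _ => 0) = 0 := map_zero D
      simp [hu0, hg00, hD0]
    · have := (hT (G (ρ', u)) i).2 n hn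
      rw [← hu] at this
      exact this.symm
  have hzval : ∀ i x, |x| ≤ 1 → (z i).evalAt x =
      D (fun j => (u j).evalAt x) i + R (ρ' * x, fun j => (u j).evalAt x) i := fun i x hx => by
    rw [← hval i x hx, hDsum, ← Wiener.evalHom_apply x hx, hz, map_add, map_sum]
    simp
  refine ⟨fun x i => (u i).evalAt (ρ'⁻¹ * x), ?_, ?_, ?_⟩
  · refine analyticAt_pi_iff.2 fun i => ?_
    have h1 : AnalyticAt ℝ (fun x : ℝ => ρ'⁻¹ * x) 0 := by fun_prop
    exact AnalyticAt.fun_comp (by simpa using (u i).analyticAt_evalAt) h1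
  · funext i
    simp [Wiener.evalAt_zero, hu0]
  · filter_upwards [ball_mem_nhds 0 hρ] with x hx
    have hx1 : |ρ'⁻¹ * x| < 1 := by
      rw [abs_mul, abs_inv, abs_of_pos hρ, inv_mul_lt_one₀ hρ]
      simpa using hx
    choose y' hy' hy'' using fun i => Wiener.hasDerivAt_evalAt (hzu i) hx1
    have hd : HasDerivAt (fun x i => (u i).evalAt (ρ'⁻¹ * x)) (fun i => y' i * ρ'⁻¹) x :=
      hasDerivAt_pi.2 fun i =>
        (hy' i).comp x (by simpa using (hasDerivAt_id x).const_mul ρ'⁻¹)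
    rw [hd.deriv]
    funext i
    have h1 := hzval i _ hx1.le
    rw [← hy'' i, mul_inv_cancel_left₀ hρ.ne'] at h1
    simp only [Pi.smul_apply, Pi.add_apply, smul_eq_mul, ← h1]
    ring

/-! ### Homogeneous polynomials, order of vanishing and the blow-up -/

theorem MvPolynomial.IsHomogeneous.eval_smul_eq {σ R : Type*} [CommSemiring R]
    {p : MvPolynomial σ R} {n : ℕ} (hp : p.IsHomogeneous n) (c : R) (v : σ → R) :
    MvPolynomial.eval (c • v) p = c ^ n * MvPolynomial.eval v p := by
  rw [MvPolynomial.eval_eq, MvPolynomial.eval_eq, Finset.mul_sum]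
  refine Finset.sum_congr rfl fun m hm => ?_
  have hdeg : ∑ i ∈ m.support, m i = n := by
    rw [← hp (MvPolynomial.mem_support_iff.1 hm), Finsupp.weight_apply, Finsupp.sum]
    simp
  simp only [Pi.smul_apply, smul_eq_mul, mul_pow, Finset.prod_mul_distrib,
    Finset.prod_pow_eq_pow_sum, hdeg]
  ring

theorem MvPolynomial.IsHomogeneous.eval_cons_smul {d : ℕ} {p : MvPolynomial (Fin (d + 1)) ℝ}
    {n : ℕ} (hp : p.IsHomogeneous n) (x : ℝ) (y : Fin d → ℝ) :
    MvPolynomial.eval (Fin.cons x (x • y)) p = x ^ n * MvPolynomial.eval (Fin.cons 1 y) p := by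
  rw [← hp.eval_smul_eq]
  congr 2
  funext i
  refine Fin.cases ?_ (fun j => ?_) i <;> simp

theorem MvPolynomial.hasFDerivAt_eval {σ E : Type*} [Fintype σ] [NormedAddCommGroup E]
    [NormedSpace ℝ E] {w : E → σ → ℝ} {w' : σ → E →L[ℝ] ℝ} {z : E}
    (hw : ∀ i, HasFDerivAt (fun z => w z i) (w' i) z) (p : MvPolynomial σ ℝ) :
    HasFDerivAt (fun z => MvPolynomial.eval (w z) p)
      (∑ i, MvPolynomial.eval (w z) (MvPolynomial.pderiv i p) • w' i) z := by
  classical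
  induction p using MvPolynomial.induction_on with
  | C c => simpa using hasFDerivAt_const c z
  | add p q hp hq =>
    simp only [map_add, add_smul, Finset.sum_add_distrib]
    exact hp.add hq
  | mul_X p i hp =>
    have h := hp.mul (hw i)
    simp only [map_mul, MvPolynomial.eval_X, Derivation.leibniz, smul_eq_mul, map_add, add_smul,
      Finset.sum_add_distrib, MvPolynomial.pderiv_X]
    refine HasFDerivAt.congr_fderiv h ?_
    congr 1
    · rw [Finset.sum_eq_single i (fun j _ hj => by simp [hj.symm]) (by simp)]
      simp
    · rw [Finset.smul_sum]
      simp [mul_smul]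

/-- The Taylor polynomial of degree below `k` vanishes, so only the Taylor remainder is left. -/
theorem HasOrderGE.isBigO {E G : Type*} [NormedAddCommGroup E] [NormedSpace ℝ E]
    [NormedAddCommGroup G] [NormedSpace ℝ G] [CompleteSpace G] {f : E → G} {k : ℕ}
    (h : HasOrderGE f k) (hf : AnalyticAt ℝ f 0) : f =O[𝓝 0] fun v => ‖v‖ ^ k := by
  obtain ⟨p, r, hp⟩ := hf
  have h1 := hp.hasFPowerSeriesAt.isBigO_sub_partialSum_pow k
  have h2 : ∀ y, p.partialSum k y = 0 := fun y => by
    refine Finset.sum_eq_zero fun j hj => ?_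
    have h3 := hp.factorial_smul y j
    rw [h j (Finset.mem_range.1 hj)] at h3
    rw [← Nat.cast_smul_eq_nsmul ℝ] at h3
    exact (smul_eq_zero.1 h3).resolve_left (Nat.cast_ne_zero.2 j.factorial_ne_zero)
  simpa [h2] using h1

/-- A germ of order `k` becomes divisible by `x ^ k` after the substitution `y = x ψ`. -/
theorem AnalyticAt.exists_blowup {d k : ℕ} {f : ℝ × (Fin d → ℝ) → ℝ} (hf : AnalyticAt ℝ f 0)
    (hk : f =O[𝓝 0] fun v => ‖v‖ ^ k) :
    ∃ F : ℝ × (Fin d → ℝ) → ℝ, AnalyticAt ℝ F 0 ∧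
      ∀ᶠ v in 𝓝 0, f (v.1, v.1 • v.2) = v.1 ^ k * F v := by
  have hβ : AnalyticAt ℝ (fun v : ℝ × (Fin d → ℝ) => (v.1, v.1 • v.2)) 0 :=
    analyticAt_fst.prod (analyticAt_fst.smul analyticAt_snd)
  have hβ0 : ((0 : ℝ × (Fin d → ℝ)).1, (0 : ℝ × (Fin d → ℝ)).1 • (0 : ℝ × (Fin d → ℝ)).2) = 0 := by
    simp
  have hfβ : AnalyticAt ℝ (fun v : ℝ × (Fin d → ℝ) => f (v.1, v.1 • v.2)) 0 :=
    AnalyticAt.fun_comp (g := f) (by rwa [hβ0]) hβ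
  obtain ⟨C, hC⟩ := hk.bound
  have ht := hβ.continuousAt.tendsto
  rw [hβ0] at ht
  -- `C` may be negative. For `‖ψ‖ < 1` the point `(x, x ψ)` has norm at most `|x|`.
  refine hfβ.exists_eq_fst_pow_mul k (C := |C|) ?_
  filter_upwards [ht.eventually hC, ball_mem_nhds 0 one_pos] with v hv hv1
  rw [mem_ball_zero_iff, Prod.norm_def, sup_lt_iff] at hv1
  have h1 : ‖(v.1, v.1 • v.2)‖ ≤ |v.1| := by
    refine max_le le_rfl ?_
    rw [norm_smul]
    exact mul_le_of_le_one_right (norm_nonneg _) hv1.2.le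
  rw [norm_pow, norm_norm] at hv
  refine hv.trans ((mul_le_mul_of_nonneg_right (le_abs_self C) (by positivity)).trans ?_)
  gcongr

/-- The continuous linear map of a matrix, as an algebra homomorphism. -/
noncomputable def Matrix.toCLMAlgHom (d : ℕ) :
    Matrix (Fin d) (Fin d) ℝ →ₐ[ℝ] ((Fin d → ℝ) →L[ℝ] (Fin d → ℝ)) :=
  (Module.End.toContinuousLinearMap (𝕜 := ℝ) (Fin d → ℝ)).toAlgHom.comp
    Matrix.toLinAlgEquiv'.toAlgHom

@[simp] theorem Matrix.toCLMAlgHom_apply {d : ℕ} (B : Matrix (Fin d) (Fin d) ℝ)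
    (y : Fin d → ℝ) : Matrix.toCLMAlgHom d B y = B.mulVec y := rfl

/-! ### The real invariant curve -/

/-- A parabolic field has an analytic real invariant curve tangent to the `x`-axis. -/
theorem IsParabolicField.exists_invariant_curve {d N M : ℕ} (hN : 2 ≤ N) (hMN : N ≤ M) {a : ℝ}
    (ha : a ≠ 0) {B₁ : Matrix (Fin d) (Fin d) ℝ} (hB : IsNonresonant N M a B₁)
    {U : Set (ℝ × (Fin d → ℝ))} {X : ℝ × (Fin d → ℝ) → ℝ × (Fin d → ℝ)}
    (hX : IsParabolicField N M a B₁ U X) :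
    ∃ φ : ℝ → (Fin d → ℝ), AnalyticAt ℝ φ 0 ∧ φ 0 = 0 ∧ HasDerivAt φ 0 0 ∧
      ∀ᶠ x in 𝓝 (0 : ℝ), (X (x, φ x)).2 = (X (x, φ x)).1 • deriv φ x := by
  obtain ⟨hU, hU0, fN, gM, fR, gR, hfN, hfN0, hgM, hgM0, hgM1, hfR, hfRk, hgR, hgRk, hXeq⟩ := hX
  obtain ⟨F, hF, hFeq⟩ := (hfR 0 hU0).exists_blowup (hfRk.isBigO (hfR 0 hU0))
  have hgRi : ∀ i, AnalyticAt ℝ (fun v => gR v i) 0 := fun i => analyticAt_pi_iff.1 (hgR 0 hU0) i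
  choose G hG hGeq using fun i => (hgRi i).exists_blowup
    (Asymptotics.isBigO_pi.1 (hgRk.isBigO (hgR 0 hU0)) i)
  have hcons : ∀ (p : MvPolynomial (Fin (d + 1)) ℝ),
      AnalyticAt ℝ (fun v : ℝ × (Fin d → ℝ) => MvPolynomial.eval (Fin.cons 1 v.2) p) 0 := fun p => by
    refine AnalyticAt.aeval_mvPolynomial
      (f := fun v : ℝ × (Fin d → ℝ) => (Fin.cons 1 v.2 : Fin (d + 1) → ℝ)) (fun i => ?_) p
    refine Fin.cases ?_ (fun j => ?_) i
    · simpa using analyticAt_const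
    · simp only [Fin.cons_succ]
      exact ((ContinuousLinearMap.proj (R := ℝ) (φ := fun _ : Fin d => ℝ) j).comp
        (ContinuousLinearMap.snd ℝ ℝ (Fin d → ℝ))).analyticAt _
  set B := Matrix.toCLMAlgHom d B₁ with hBdef
  set den : ℝ × (Fin d → ℝ) → ℝ := fun v =>
    -a + MvPolynomial.eval (Fin.cons 1 v.2) fN + v.1 * F v with hden
  set num : ℝ × (Fin d → ℝ) → (Fin d → ℝ) := fun v =>
    B v.2 + (fun i => MvPolynomial.eval (Fin.cons 1 v.2) (gM i)) + fun i => v.1 * G i v with hnum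
  have hden' : AnalyticAt ℝ den 0 :=
    (analyticAt_const.add (hcons fN)).add (analyticAt_fst.mul hF)
  have hden0 : den 0 = -a := by simp [hden, hfN0]
  have hdenne : den 0 ≠ 0 := by
    rw [hden0]
    exact neg_ne_zero.2 ha
  have hnum' : AnalyticAt ℝ num 0 :=
    (((B.analyticAt _).comp analyticAt_snd).add (analyticAt_pi_iff.2 fun i => hcons (gM i))).add
      (analyticAt_pi_iff.2 fun i => analyticAt_fst.mul (hG i))
  -- `s` is `1` if `M = N` and `0` if `M > N`; it is the value of `x^(M-N)` at `x = 0`.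
  set s : ℝ := 0 ^ (M - N) with hs
  set D : (Fin d → ℝ) →L[ℝ] (Fin d → ℝ) := -1 - (s * a⁻¹) • B with hD
  set R : ℝ × (Fin d → ℝ) → (Fin d → ℝ) := fun v =>
    (v.1 ^ (M - N) * (den v)⁻¹) • num v - v.2 - D v.2 with hR
  have hR' : AnalyticAt ℝ R 0 :=
    (((((analyticAt_fst.pow _).mul (hden'.inv hdenne)).smul hnum').sub
      analyticAt_snd).sub ((D.analyticAt _).comp analyticAt_snd))
  have hR0 : R 0 = 0 := by
    have : num 0 = 0 := by
      funext i
      simp [hnum, hgM0]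
    simp [hR, this]
  have hunit : ∀ k : ℕ, 1 ≤ k →
      IsUnit (algebraMap ℝ ((Fin d → ℝ) →L[ℝ] (Fin d → ℝ)) k - D) := fun k hk => by
    rcases hMN.lt_or_eq with hlt | rfl
    · have h0 : algebraMap ℝ ((Fin d → ℝ) →L[ℝ] (Fin d → ℝ)) k - D =
          algebraMap ℝ _ ((k : ℝ) + 1) := by
        have : s = 0 := by simp [hs]; omega
        simp [hD, this]
      rw [h0]
      exact (IsUnit.mk0 _ (by positivity)).map _
    -- The blow-up shifts the index by one: `k - D = a⁻¹ (B₁ + (k + 1) a Id)`, so `k ≥ 1`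
    -- corresponds to `l = k + 1 ≥ 2`.
    · have h1 := (hB.2 rfl (k + 1) (by omega)).map (Matrix.toCLMAlgHom d)
      have h0 : algebraMap ℝ ((Fin d → ℝ) →L[ℝ] (Fin d → ℝ)) k - D =
          algebraMap ℝ _ a⁻¹ * Matrix.toCLMAlgHom d
            (B₁ + (((k + 1 : ℕ) : ℝ) * a) • (1 : Matrix (Fin d) (Fin d) ℝ)) := by
        simp only [map_add, map_smul, map_one, ← hBdef, hD, hs, Algebra.algebraMap_eq_smul_one]
        ext y i
        simp
        field_simp
        ring
      rw [h0]
      exact ((IsUnit.mk0 _ (inv_ne_zero ha)).map _).mul h1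
  have hRder : ∀ y, fderiv ℝ R 0 (0, y) = 0 := fun y => by
    have h1 : HasFDerivAt (fun y : Fin d → ℝ => R (0, y))
        ((fderiv ℝ R 0).comp (ContinuousLinearMap.inr ℝ ℝ (Fin d → ℝ))) 0 :=
      HasFDerivAt.comp (g := R) (f := fun y : Fin d → ℝ => ((0 : ℝ), y)) (0 : Fin d → ℝ)
        hR'.differentiableAt.hasFDerivAt (hasFDerivAt_prodMk_right _ _)
    have hcons' : ∀ i : Fin (d + 1), HasFDerivAt
        (fun y : Fin d → ℝ => (Fin.cons 1 y : Fin (d + 1) → ℝ) i)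
        ((Fin.cons 0 fun j => ContinuousLinearMap.proj j :
          Fin (d + 1) → (Fin d → ℝ) →L[ℝ] ℝ) i) 0 := fun i => by
      refine Fin.cases ?_ (fun j => ?_) i
      · simpa using hasFDerivAt_const (1 : ℝ) (0 : Fin d → ℝ)
      · simpa only [Fin.cons_succ] using hasFDerivAt_apply j (0 : Fin d → ℝ)
    have hg : HasFDerivAt (fun y : Fin d → ℝ => fun i =>
        MvPolynomial.eval (Fin.cons 1 y) (gM i)) (0 : (Fin d → ℝ) →L[ℝ] (Fin d → ℝ)) 0 := by
      refine hasFDerivAt_pi'.2 fun i => ?_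
      have h := MvPolynomial.hasFDerivAt_eval hcons' (gM i)
      simpa [Fin.sum_univ_succ, hgM1] using h
    have hq : DifferentiableAt ℝ (fun y : Fin d → ℝ => s * (den (0, y))⁻¹) 0 := by
      have h3 : AnalyticAt ℝ (fun y : Fin d → ℝ => den (0, y)) 0 :=
        AnalyticAt.fun_comp (g := den) (f := fun y : Fin d → ℝ => ((0 : ℝ), y)) hden' (by fun_prop)
      exact ((h3.inv hdenne).differentiableAt).const_mul s
    have hu := (B.hasFDerivAt (x := 0)).add hg
    -- Since `num` vanishes at the origin, differentiating `den⁻¹` contributes nothing; what remains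
    -- is `-s a⁻¹ B - 1 - D = 0`.
    have h2 := ((hq.hasFDerivAt.smul hu).sub (hasFDerivAt_id (𝕜 := ℝ) (0 : Fin d → ℝ))).sub
      (D.hasFDerivAt (x := 0))
    have h3 := h1.unique (h2.congr_of_eventuallyEq (Eventually.of_forall fun y => by
      simp only [hR, hnum, zero_mul]
      change _ = (s * (den (0, y))⁻¹) • (B y +
        fun i => MvPolynomial.eval (Fin.cons 1 y) (gM i)) - y - D y
      rw [show (fun _ : Fin d => (0 : ℝ)) = 0 from rfl, add_zero]))
    have h4 := DFunLike.congr_fun h3 y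
    have hden0' : den (0, 0) = -a := hden0
    have hgz : (fun i => MvPolynomial.eval (Fin.cons 1 (0 : Fin d → ℝ)) (gM i)) = 0 :=
      funext fun i => hgM0 i 1
    simp [hgz, hden0', hD] at h4
    rw [h4]
    funext i
    simp only [Pi.sub_apply, Pi.neg_apply, Pi.zero_apply]
    ring
  obtain ⟨ψ, hψ, hψ0, hψeq⟩ := briot_bouquet D hunit hR' hR0 hRder
  have hder : ∀ᶠ x in 𝓝 (0 : ℝ), HasDerivAt (fun x => x • ψ x) (ψ x + x • deriv ψ x) x := by
    filter_upwards [hψ.eventually_analyticAt] with x hx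
    exact ((hasDerivAt_id' x).fun_smul hx.differentiableAt.hasDerivAt).congr_deriv (by
      rw [one_smul, add_comm])
  have hlim : Tendsto (fun x => (x, ψ x)) (𝓝 0) (𝓝 0) := by
    have h : ContinuousAt (fun x => (x, ψ x)) 0 := continuousAt_id.prodMk hψ.continuousAt
    rw [ContinuousAt, hψ0] at h
    exact h
  have hlim' : Tendsto (fun x => (x, x • ψ x)) (𝓝 0) (𝓝 0) := by
    have h : ContinuousAt (fun x => (x, x • ψ x)) 0 :=
      continuousAt_id.prodMk (continuousAt_id.smul hψ.continuousAt)
    rw [ContinuousAt, hψ0, smul_zero] at h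
    exact h
  have hder0 := hder.self_of_nhds
  rw [hψ0, zero_smul, add_zero] at hder0
  refine ⟨fun x => x • ψ x, analyticAt_id.smul hψ, by simp, hder0, ?_⟩
  filter_upwards [hder, hψeq, hlim'.eventually (hU.mem_nhds hU0), hlim.eventually hFeq,
    hlim.eventually (eventually_all.2 hGeq),
    hlim.eventually (hden'.continuousAt.eventually_ne hdenne)]
    with x hx hψx hxU hFx hGx hdx
  have hd : ψ x + x • deriv ψ x = (x ^ (M - N) * (den (x, ψ x))⁻¹) • num (x, ψ x) := by
    rw [hψx, hR]
    funext i
    simp only [Pi.add_apply, Pi.sub_apply]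
    ring
  have hX1 : (X (x, x • ψ x)).1 = x ^ N * den (x, ψ x) := by
    rw [hXeq _ _ hxU, hfN.eval_cons_smul, hFx, hden]
    ring
  have hX2 : (X (x, x • ψ x)).2 = x ^ M • num (x, ψ x) := by
    rw [hXeq _ _ hxU, hnum]
    funext i
    have hpow : x ^ (M - 1) * x = x ^ M := by rw [← pow_succ]; congr 1; omega
    simp only [Pi.add_apply, Pi.smul_apply, smul_eq_mul, (hgM i).eval_cons_smul, hGx i,
      Matrix.mulVec_smul, hBdef, Matrix.toCLMAlgHom_apply, pow_succ x M, ← hpow]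
    ring
  -- Both sides equal `x^M num`, because `x^N x^(M-N) = x^M` and `den ≠ 0`; there is no division by
  -- `x`.
  rw [hx.deriv, hd, hX1, hX2, smul_smul]
  congr 1
  rw [← Nat.sub_add_cancel hMN, pow_add, Nat.add_sub_cancel]
  field_simp

/-! ### Complexification of real analytic germs -/

section Complexification

/-- The standard coordinates of `ℂ × ℂ ^ d`. -/
noncomputable def coordForm (d : ℕ) : Option (Fin d) → ℂ × (Fin d → ℂ) →L[ℂ] ℂ := fun i =>
  i.elim (ContinuousLinearMap.fst ℂ ℂ (Fin d → ℂ)) fun j =>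
    (ContinuousLinearMap.proj j).comp (ContinuousLinearMap.snd ℂ ℂ (Fin d → ℂ))

@[simp] theorem norm_complexify {d : ℕ} (y : Fin d → ℝ) : ‖complexify y‖ = ‖y‖ := by
  simp [complexify, Pi.norm_def]

@[simp] theorem complexify_zero {d : ℕ} : complexify (0 : Fin d → ℝ) = 0 := by
  funext i
  simp [complexify]

/-- The algebra is `ℂ` itself, and its only needed character is the identity. -/
theorem AnalyticAt.exists_complex_extension {d : ℕ} {f : ℝ × (Fin d → ℝ) → ℝ}
    (hf : AnalyticAt ℝ f 0) :
    ∃ (g : ℂ × (Fin d → ℂ) → ℂ) (ε : ℝ), 0 < ε ∧ AnalyticOnNhd ℂ g (ball 0 ε) ∧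
      ∀ (x : ℝ) (y : Fin d → ℝ), ((x : ℂ), complexify y) ∈ ball (0 : ℂ × (Fin d → ℂ)) ε →
        g (x, complexify y) = f (x, y) := by
  obtain ⟨g, ε, hε, hg, -, -, hgχ⟩ := hf.exists_algExt (coordVec ℝ d) (coordForm d)
  refine ⟨g, ε, hε, hg, fun x y hv => ?_⟩
  have hn : ‖(x, y)‖ < ε := by
    rw [mem_ball_zero_iff, Prod.norm_def] at hv
    rw [Prod.norm_def]
    simpa using hv
  have h := hgχ _ hv (AlgHom.id ℂ ℂ) continuous_id (fun i => i.elim x y)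
    (norm_option_elim_lt hn) (by rintro (_ | j) <;> simp [coordForm, complexify])
  rw [sum_smul_coordVec] at h
  simpa using h

theorem AnalyticAt.exists_complex_extension_pi {d m : ℕ} {f : ℝ × (Fin d → ℝ) → (Fin m → ℝ)}
    (hf : AnalyticAt ℝ f 0) :
    ∃ (g : ℂ × (Fin d → ℂ) → (Fin m → ℂ)) (ε : ℝ), 0 < ε ∧ AnalyticOnNhd ℂ g (ball 0 ε) ∧
      ∀ (x : ℝ) (y : Fin d → ℝ), ((x : ℂ), complexify y) ∈ ball (0 : ℂ × (Fin d → ℂ)) ε →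
        g (x, complexify y) = complexify (f (x, y)) := by
  choose g ε hε hg hgf using fun i => (analyticAt_pi_iff.1 hf i).exists_complex_extension
  obtain ⟨e, he, hle⟩ := exists_pos_forall_le hε
  refine ⟨fun v i => g i v, e, he, fun v hv => analyticAt_pi_iff.2 fun i =>
    hg i v (ball_subset_ball (hle i) hv), fun x y hv => funext fun i => ?_⟩
  exact hgf i x y (ball_subset_ball (hle i) hv)

theorem deriv_eq_complexify_deriv {d : ℕ} {φ : ℝ → (Fin d → ℝ)} {φc : ℂ → (Fin d → ℂ)} {x : ℝ}
    (h : ∀ᶠ t : ℝ in 𝓝 x, φc (t : ℂ) = complexify (φ t)) (hφ : DifferentiableAt ℝ φ x)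
    (hφc : DifferentiableAt ℂ φc x) : deriv φc x = complexify (deriv φ x) := by
  have h1 : HasDerivAt (fun t : ℝ => complexify (φ t)) (complexify (deriv φ x)) x :=
    hasDerivAt_pi.2 fun i => (hasDerivAt_pi.1 hφ.hasDerivAt i).ofReal_comp
  have h2 : HasDerivAt (fun t : ℝ => φc t) (deriv φc x) x :=
    hasDerivAt_pi.2 fun i => (hasDerivAt_pi.1 hφc.hasDerivAt i).comp_ofReal
  exact h2.unique (h1.congr_of_eventuallyEq h)

end Complexification

/-! ### Analyticity of the field and the equilibrium at the origin -/

namespace IsParabolicField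

variable {d N M : ℕ} {a : ℝ} {B₁ : Matrix (Fin d) (Fin d) ℝ} {U : Set (ℝ × (Fin d → ℝ))}
  {X : ℝ × (Fin d → ℝ) → ℝ × (Fin d → ℝ)}

theorem analyticAt (hX : IsParabolicField N M a B₁ U X) : AnalyticAt ℝ X 0 := by
  obtain ⟨hU, hU0, fN, gM, fR, gR, -, -, -, -, -, hfR, -, hgR, -, hXeq⟩ := hX
  have hcons : ∀ (p : MvPolynomial (Fin (d + 1)) ℝ), AnalyticAt ℝ
      (fun v : ℝ × (Fin d → ℝ) => MvPolynomial.eval (Fin.cons v.1 v.2) p) 0 := fun p => by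
    refine AnalyticAt.aeval_mvPolynomial
      (f := fun v : ℝ × (Fin d → ℝ) => (Fin.cons v.1 v.2 : Fin (d + 1) → ℝ)) (fun i => ?_) p
    refine Fin.cases ?_ (fun j => ?_) i
    · simpa only [Fin.cons_zero] using analyticAt_fst
    · simp only [Fin.cons_succ]
      exact ((ContinuousLinearMap.proj (R := ℝ) (φ := fun _ : Fin d => ℝ) j).comp
        (ContinuousLinearMap.snd ℝ ℝ (Fin d → ℝ))).analyticAt _
  have h1 : AnalyticAt ℝ (fun v : ℝ × (Fin d → ℝ) =>
      -a * v.1 ^ N + MvPolynomial.eval (Fin.cons v.1 v.2) fN + fR v) 0 :=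
    ((analyticAt_const.mul (analyticAt_fst.pow _)).add (hcons fN)).add (hfR 0 hU0)
  have h2 : AnalyticAt ℝ (fun v : ℝ × (Fin d → ℝ) => v.1 ^ (M - 1) • B₁.mulVec v.2 +
      (fun i => MvPolynomial.eval (Fin.cons v.1 v.2) (gM i)) + gR v) 0 :=
    (((analyticAt_fst.pow _).smul (((Matrix.toCLMAlgHom d B₁).analyticAt _).comp
      analyticAt_snd)).add (analyticAt_pi_iff.2 fun i => hcons (gM i))).add (hgR 0 hU0)
  refine (h1.prod h2).congr ?_
  filter_upwards [hU.mem_nhds hU0] with v hv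
  exact (hXeq v.1 v.2 hv).symm

theorem apply_zero (hN : N ≠ 0) (hX : IsParabolicField N M a B₁ U X) :
    X 0 = 0 := by
  obtain ⟨hU, hU0, fN, gM, fR, gR, -, hfN0, -, hgM0, -, -, hfR, -, hgR, hXeq⟩ := hX
  have h1 : fR (0, 0) = 0 := by
    rw [← iteratedFDeriv_zero_apply (𝕜 := ℝ) (f := fR) 0]
    exact congrArg (fun L => L 0) (hfR 0 (by omega))
  have h2 : gR (0, 0) = 0 := by
    rw [← iteratedFDeriv_zero_apply (𝕜 := ℝ) (f := gR) 0]
    exact congrArg (fun L => L 0) (hgR 0 (by omega))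
  have h3 : (fun i => MvPolynomial.eval (Fin.cons 0 (0 : Fin d → ℝ)) (gM i)) = 0 :=
    funext fun i => hgM0 i 0
  refine (hXeq 0 0 hU0).trans ?_
  rw [h1, h2, h3, hfN0, Matrix.mulVec_zero]
  simp [hN]

end IsParabolicField

/-! ### The holomorphic invariant curve -/

/-- The real and holomorphic invariant curves, once a germ of real invariant curve is known. -/
theorem exists_holomorphic_invariant_curve {d : ℕ} {U : Set (ℝ × (Fin d → ℝ))}
    {X : ℝ × (Fin d → ℝ) → ℝ × (Fin d → ℝ)} (hU : U ∈ 𝓝 0) (hX : AnalyticAt ℝ X 0)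
    {φ : ℝ → (Fin d → ℝ)} (hφ : AnalyticAt ℝ φ 0) (hφ0 : φ 0 = 0)
    (heq : ∀ᶠ x in 𝓝 (0 : ℝ), (X (x, φ x)).2 = (X (x, φ x)).1 • deriv φ x) :
    ∃ (V : Set (ℂ × (Fin d → ℂ))) (Xc : ℂ × (Fin d → ℂ) → ℂ × (Fin d → ℂ))
        (ρ : ℝ) (φc : ℂ → (Fin d → ℂ)),
      IsHolomorphicExtension U X V Xc ∧ 0 < ρ ∧
      AnalyticOnNhd ℂ φc (ball 0 ρ) ∧
      (∀ x ∈ ball (0 : ℝ) ρ, φc (x : ℂ) = complexify (φ x)) ∧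
      SolvesInvariance U X (ball 0 ρ) φ ∧
      SolvesInvariance V Xc (ball 0 ρ) φc := by
  obtain ⟨g₁, ε₁, hε₁, hg₁, hgX₁⟩ :=
    (analyticAt_fst.comp hX : AnalyticAt ℝ (fun v => (X v).1) 0).exists_complex_extension
  obtain ⟨g₂, ε₂, hε₂, hg₂, hgX₂⟩ :=
    (analyticAt_snd.comp hX : AnalyticAt ℝ (fun v => (X v).2) 0).exists_complex_extension_pi
  -- The curve is regarded as a germ on `ℝ × ℝ^0`, so that the extension result applies to it.
  have hφ' : AnalyticAt ℝ (fun v : ℝ × (Fin 0 → ℝ) => φ v.1) 0 :=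
    AnalyticAt.fun_comp (g := φ) hφ analyticAt_fst
  obtain ⟨g₃, ε₃, hε₃, hg₃, hgφ⟩ := hφ'.exists_complex_extension_pi
  set φc : ℂ → (Fin d → ℂ) := fun z => g₃ (z, 0) with hφcdef
  have hmem : ∀ z ∈ ball (0 : ℂ) ε₃, (z, (0 : Fin 0 → ℂ)) ∈ ball (0 : ℂ × (Fin 0 → ℂ)) ε₃ :=
    fun z hz => by
      rw [mem_ball_zero_iff] at hz ⊢
      rw [Prod.norm_def, norm_zero]
      exact max_lt hz hε₃
  have hφc : AnalyticOnNhd ℂ φc (ball 0 ε₃) := fun z hz =>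
    AnalyticAt.fun_comp (g := g₃) (f := fun z : ℂ => (z, (0 : Fin 0 → ℂ)))
      (hg₃ _ (hmem z hz)) (analyticAt_id.prod analyticAt_const)
  have hofReal : ∀ x ∈ ball (0 : ℝ) ε₃, (x : ℂ) ∈ ball (0 : ℂ) ε₃ := fun x hx => by
    simpa using hx
  have hφφ : ∀ x ∈ ball (0 : ℝ) ε₃, φc (x : ℂ) = complexify (φ x) := fun x hx => by
    have h := hgφ x 0 (by rw [complexify_zero]; exact hmem _ (hofReal x hx))
    rwa [complexify_zero] at h
  have hφc0 : φc 0 = 0 := by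
    simpa [hφ0] using hφφ 0 (mem_ball_self hε₃)
  set V : Set (ℂ × (Fin d → ℂ)) := ball 0 (min ε₁ ε₂) with hV
  have hε : 0 < min ε₁ ε₂ := lt_min hε₁ hε₂
  set Xc : ℂ × (Fin d → ℂ) → ℂ × (Fin d → ℂ) := fun v => (g₁ v, g₂ v) with hXcdef
  have hXc : AnalyticOnNhd ℂ Xc V := fun v hv =>
    (hg₁ v (ball_subset_ball (min_le_left _ _) hv)).prod
      (hg₂ v (ball_subset_ball (min_le_right _ _) hv))
  have hXX : ∀ (x : ℝ) (y : Fin d → ℝ), ((x : ℂ), complexify y) ∈ V →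
      Xc ((x : ℂ), complexify y) = (((X (x, y)).1 : ℂ), complexify (X (x, y)).2) := fun x y hv => by
    simp only [hXcdef, hgX₁ x y (ball_subset_ball (min_le_left _ _) hv),
      hgX₂ x y (ball_subset_ball (min_le_right _ _) hv), Function.comp_apply]
  have hφcA := hφc 0 (mem_ball_self hε₃)
  have hgraph : AnalyticAt ℂ (fun z => (z, φc z)) 0 := analyticAt_id.prod hφcA
  have hXgraph : AnalyticAt ℂ (fun z => Xc (z, φc z)) 0 :=
    AnalyticAt.fun_comp (g := Xc) (by rw [hφc0]; exact hXc 0 (mem_ball_self hε)) hgraph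
  have hdef : AnalyticAt ℂ
      (fun z => (Xc (z, φc z)).2 - (Xc (z, φc z)).1 • deriv φc z) 0 :=
    (analyticAt_snd.comp hXgraph).sub
      ((analyticAt_fst.comp hXgraph).smul hφcA.deriv)
  have hVev : ∀ᶠ z in 𝓝 (0 : ℂ), (z, φc z) ∈ V := by
    refine hgraph.continuousAt.eventually_mem ?_
    rw [hφc0]
    exact ball_mem_nhds 0 hε
  have hUev : ∀ᶠ x in 𝓝 (0 : ℝ), (x, φ x) ∈ U := by
    refine (continuousAt_id.prodMk hφ.continuousAt).eventually_mem ?_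
    rw [hφ0]
    exact hU
  have hc : Tendsto (fun x : ℝ => (x : ℂ)) (𝓝 0) (𝓝 0) :=
    Complex.continuous_ofReal.tendsto' 0 0 Complex.ofReal_zero
  have hreal : ∀ᶠ x : ℝ in 𝓝 (0 : ℝ),
      (Xc ((x : ℂ), φc x)).2 - (Xc ((x : ℂ), φc x)).1 • deriv φc x = 0 := by
    filter_upwards [heq, hc.eventually hVev, ball_mem_nhds 0 hε₃, hφ.eventually_analyticAt]
      with x hx hxV hxε hxφ
    have hd : deriv φc x = complexify (deriv φ x) :=
      deriv_eq_complexify_deriv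
        (Filter.eventually_of_mem (isOpen_ball.mem_nhds hxε) hφφ)
        hxφ.differentiableAt (hφc x (hofReal x hxε)).differentiableAt
    rw [hφφ x hxε] at hxV ⊢
    rw [hXX _ _ hxV, hd, hx, sub_eq_zero]
    funext i
    simp [complexify]
  -- Zeros of the analytic defect on the real axis accumulate at `0`, so the defect vanishes near
  -- `0`.
  have hfreq : ∃ᶠ z in 𝓝[≠] (0 : ℂ),
      (Xc (z, φc z)).2 - (Xc (z, φc z)).1 • deriv φc z = 0 := by
    have h1 : Tendsto (fun x : ℝ => (x : ℂ)) (𝓝[≠] 0) (𝓝[≠] 0) :=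
      tendsto_nhdsWithin_iff.2 ⟨hc.mono_left nhdsWithin_le_nhds,
        eventually_nhdsWithin_of_forall fun x hx => by simpa using hx⟩
    exact h1.frequently (hreal.filter_mono nhdsWithin_le_nhds).frequently
  have hcomplex := hdef.frequently_zero_iff_eventually_zero.1 hfreq
  obtain ⟨ρ₁, hρ₁, h₁⟩ := Metric.eventually_nhds_iff_ball.1 (hcomplex.and hVev)
  obtain ⟨ρ₂, hρ₂, h₂⟩ := Metric.eventually_nhds_iff_ball.1 (heq.and hUev)
  refine ⟨V, Xc, min ε₃ (min ρ₁ ρ₂), φc,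
    ⟨isOpen_ball, mem_ball_self hε, hXc, fun x y _ hv => hXX x y hv⟩,
    lt_min hε₃ (lt_min hρ₁ hρ₂), fun z hz => hφc z (ball_subset_ball (min_le_left _ _) hz),
    fun x hx => hφφ x (ball_subset_ball (min_le_left _ _) hx), fun x hx => ?_, fun z hz => ?_⟩
  · have := h₂ x (ball_subset_ball ((min_le_right _ _).trans (min_le_right _ _)) hx)
    exact ⟨this.2, this.1⟩
  · have := h₁ z (ball_subset_ball ((min_le_right _ _).trans (min_le_left _ _)) hz)
    exact ⟨this.2, sub_eq_zero.1 this.1⟩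

/-! ### Invariance under the time-one map -/

/-- An invariant curve of a vector field is invariant under its time-one map. -/
theorem exists_graph_invariant_timeOneMap {d : ℕ} {U : Set (ℝ × (Fin d → ℝ))}
    {X : ℝ × (Fin d → ℝ) → ℝ × (Fin d → ℝ)} (hX : AnalyticAt ℝ X 0) (hX0 : X 0 = 0)
    {φ : ℝ → (Fin d → ℝ)} (hφ : AnalyticAt ℝ φ 0) (hφ0 : φ 0 = 0)
    (heq : ∀ᶠ x in 𝓝 (0 : ℝ), (X (x, φ x)).2 = (X (x, φ x)).1 • deriv φ x)
    {W : Set (ℝ × (Fin d → ℝ))} {F : ℝ × (Fin d → ℝ) → ℝ × (Fin d → ℝ)}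
    (hF : IsTimeOneMap U X W F) :
    ∃ ρ δ : ℝ, 0 < δ ∧ δ ≤ ρ ∧ AnalyticOnNhd ℝ φ (ball 0 ρ) ∧
      ∀ x ∈ ball (0 : ℝ) δ, (x, φ x) ∈ W ∧ (F (x, φ x)).1 ∈ ball (0 : ℝ) ρ ∧
        (F (x, φ x)).2 = φ (F (x, φ x)).1 := by
  obtain ⟨hW, hW0, hγ⟩ := hF
  have hgr : Tendsto (fun x => (x, φ x)) (𝓝 0) (𝓝 0) := by
    have h : ContinuousAt (fun x => (x, φ x)) 0 := continuousAt_id.prodMk hφ.continuousAt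
    rw [ContinuousAt, hφ0] at h
    exact h
  -- The defect `Z = X^y - φ'(x) X^x` is locally Lipschitz and vanishes on the graph. Along a
  -- trajectory it is the derivative of `y - φ(x)`.
  have hZ : AnalyticAt ℝ (fun v : ℝ × (Fin d → ℝ) => (X v).2 - (X v).1 • deriv φ v.1) 0 :=
    (analyticAt_snd.comp hX).sub ((analyticAt_fst.comp hX).smul
      (AnalyticAt.fun_comp (g := deriv φ) hφ.deriv analyticAt_fst))
  obtain ⟨K₁, s₁, hs₁, hK₁⟩ := (hX.contDiffAt (n := 1)).exists_lipschitzOnWith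
  obtain ⟨K₂, s₂, hs₂, hK₂⟩ := (hZ.contDiffAt (n := 1)).exists_lipschitzOnWith
  obtain ⟨r₁, hr₁, h₁⟩ := Metric.eventually_nhds_iff_ball.1
    ((eventually_mem_set.2 hs₁).and (eventually_mem_set.2 hs₂))
  obtain ⟨r₂, hr₂, h₂⟩ := Metric.eventually_nhds_iff_ball.1
    ((hφ.eventually_analyticAt.and heq).and (hgr.eventually_mem hs₂))
  obtain ⟨r, hr, hrr₁, hrr₂⟩ : ∃ r > 0, r ≤ r₁ ∧ r ≤ r₂ :=
    ⟨min r₁ r₂, lt_min hr₁ hr₂, min_le_left _ _, min_le_right _ _⟩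
  have hXle : ∀ p ∈ ball (0 : ℝ × (Fin d → ℝ)) r, ‖X p‖ ≤ K₁ * ‖p‖ := fun p hp => by
    simpa [hX0] using hK₁.norm_sub_le (h₁ p (ball_subset_ball hrr₁ hp)).1 (mem_of_mem_nhds hs₁)
  -- The excess of `L` over `K₁` gives the strict inequality required by the comparison lemma; `η`
  -- is chosen so that `η e^L = r / 2`.
  set L : ℝ := K₁ + 1 with hL
  have hL1 : 0 < L := by positivity
  set η : ℝ := r / 2 * Real.exp (-L) with hη
  have hη0 : 0 < η := by positivity
  obtain ⟨δ, hδ, h₃⟩ := Metric.eventually_nhds_iff_ball.1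
    ((hgr.eventually_mem (hW.mem_nhds hW0)).and (hgr.eventually_mem (ball_mem_nhds 0 hη0)))
  refine ⟨r, min δ r, lt_min hδ hr, min_le_right _ _,
    fun x hx => (h₂ x (ball_subset_ball hrr₂ hx)).1.1, fun x hx => ?_⟩
  obtain ⟨hxW, hxη⟩ := h₃ x (ball_subset_ball (min_le_left _ _) hx)
  refine ⟨hxW, ?_⟩
  obtain ⟨γ, hγ0, hγ1, hγ'⟩ := hγ _ hxW
  have hcont : ContinuousOn γ (Set.Icc 0 1) := fun t ht => (hγ' t ht).2.continuousWithinAt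
  have hIci : ∀ t ∈ Set.Ico (0 : ℝ) 1, Set.Icc (0 : ℝ) 1 ∈ 𝓝[≥] t := fun t ht =>
    Icc_mem_nhdsGE_of_mem ht
  have hBle : ∀ t ∈ Set.Icc (0 : ℝ) 1, η * Real.exp (L * t) ≤ r / 2 := fun t ht => by
    rw [hη, mul_assoc, ← Real.exp_add]
    refine mul_le_of_le_one_right (by positivity) (Real.exp_le_one_iff.2 ?_)
    nlinarith [ht.2]
  have htrap : ∀ t ∈ Set.Icc (0 : ℝ) 1, ‖γ t‖ ≤ η * Real.exp (L * t) := by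
    refine image_norm_le_of_norm_deriv_right_lt_deriv_boundary
      (B' := fun t => η * (Real.exp (L * t) * L)) hcont
      (fun t ht => (hγ' t (Set.Ico_subset_Icc_self ht)).2.mono_of_mem_nhdsWithin (hIci t ht))
      ?_ (fun t => ?_) (fun t ht hB => ?_)
    · rw [hγ0]
      simpa using (mem_ball_zero_iff.1 hxη).le
    · simpa using (((hasDerivAt_id t).const_mul L).exp).const_mul η
    · have hlt : ‖γ t‖ < r := by
        rw [hB]
        linarith [hBle t (Set.Ico_subset_Icc_self ht)]
      refine (hXle _ (mem_ball_zero_iff.2 hlt)).trans_lt ?_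
      rw [hB, hL]
      have : 0 < η * Real.exp (L * t) := by positivity
      nlinarith
  have hball : ∀ t ∈ Set.Icc (0 : ℝ) 1, ‖γ t‖ < r := fun t ht => by
    linarith [htrap t ht, hBle t ht]
  have hfst : ∀ t ∈ Set.Icc (0 : ℝ) 1, (γ t).1 ∈ ball (0 : ℝ) r := fun t ht =>
    mem_ball_zero_iff.2 ((norm_fst_le _).trans_lt (hball t ht))
  have hz' : ∀ t ∈ Set.Icc (0 : ℝ) 1, HasDerivWithinAt (fun t => (γ t).2 - φ (γ t).1)
      ((X (γ t)).2 - (X (γ t)).1 • deriv φ (γ t).1) (Set.Icc 0 1) t := fun t ht => by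
    have h1 := (hγ' t ht).2
    have h2 := (h₂ _ (ball_subset_ball hrr₂ (hfst t ht))).1.1.differentiableAt.hasDerivAt
    have hs := (ContinuousLinearMap.snd ℝ ℝ (Fin d → ℝ)).hasFDerivAt.comp_hasDerivWithinAt t h1
    have hf := (ContinuousLinearMap.fst ℝ ℝ (Fin d → ℝ)).hasFDerivAt.comp_hasDerivWithinAt t h1
    exact hs.sub (h2.scomp_hasDerivWithinAt t hf)
  -- Comparing `γ t` with the graph point over the same `x` gives `‖z'‖ ≤ K₂ ‖z‖` for `z = y -
  -- φ(x)`. As `z(0) = 0`, Grönwall forces `z = 0`.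
  have hz : ∀ t ∈ Set.Icc (0 : ℝ) 1, (γ t).2 - φ (γ t).1 = 0 := by
    refine eq_zero_of_abs_deriv_le_mul_abs_self_of_eq_zero_right (K := K₂)
      (fun t ht => (hz' t ht).continuousWithinAt)
      (fun t ht => (hz' t (Set.Ico_subset_Icc_self ht)).mono_of_mem_nhdsWithin (hIci t ht))
      (by simp [hγ0]) fun t ht => ?_
    have ht' := Set.Ico_subset_Icc_self ht
    obtain ⟨⟨-, hinv⟩, hs⟩ := h₂ _ (ball_subset_ball hrr₂ (hfst t ht'))
    have h := hK₂.norm_sub_le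
      (h₁ _ (ball_subset_ball hrr₁ (mem_ball_zero_iff.2 (hball t ht')))).2 hs
    simp only [hinv, sub_self, sub_zero] at h
    refine h.trans (le_of_eq ?_)
    congr 1
    rw [Prod.norm_def]
    simp
  rw [← hγ1]
  exact ⟨hfst 1 (by simp), sub_eq_zero.1 (hz 1 (by simp))⟩

theorem claim4p2 (d N M : ℕ) (hN : 2 ≤ N) (hMN : N ≤ M) (a : ℝ) (ha : a ≠ 0)
    (B₁ : Matrix (Fin d) (Fin d) ℝ) (hB : IsNonresonant N M a B₁)
    (U : Set (ℝ × (Fin d → ℝ))) (X : ℝ × (Fin d → ℝ) → ℝ × (Fin d → ℝ))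
    (hX : IsParabolicField N M a B₁ U X) :
    (∃ (V : Set (ℂ × (Fin d → ℂ))) (Xc : ℂ × (Fin d → ℂ) → ℂ × (Fin d → ℂ))
        (ρ : ℝ) (φ : ℝ → (Fin d → ℝ)) (φc : ℂ → (Fin d → ℂ)),
      IsHolomorphicExtension U X V Xc ∧ 0 < ρ ∧
      AnalyticOnNhd ℂ φc (ball 0 ρ) ∧
      (∀ x ∈ ball (0 : ℝ) ρ, φc (x : ℂ) = complexify (φ x)) ∧
      φ 0 = 0 ∧ HasDerivAt φ 0 0 ∧
      SolvesInvariance U X (ball 0 ρ) φ ∧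
      SolvesInvariance V Xc (ball 0 ρ) φc) ∧
    (∀ (W : Set (ℝ × (Fin d → ℝ))) (F : ℝ × (Fin d → ℝ) → ℝ × (Fin d → ℝ)),
      IsTimeOneMap U X W F →
      ∃ (ρ δ : ℝ) (Φ : ℝ → (Fin d → ℝ)), 0 < δ ∧ δ ≤ ρ ∧
        AnalyticOnNhd ℝ Φ (ball 0 ρ) ∧ Φ 0 = 0 ∧ HasDerivAt Φ 0 0 ∧
        ∀ x ∈ ball (0 : ℝ) δ,
          (x, Φ x) ∈ W ∧ (F (x, Φ x)).1 ∈ ball (0 : ℝ) ρ ∧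
          (F (x, Φ x)).2 = Φ (F (x, Φ x)).1) := by
  obtain ⟨φ, hφ, hφ0, hφ', heq⟩ := hX.exists_invariant_curve hN hMN ha hB
  refine ⟨?_, fun W F hF => ?_⟩
  · obtain ⟨V, Xc, ρ, φc, hXc, hρ, hφc, hφφ, hinv, hinvc⟩ := exists_holomorphic_invariant_curve
      (hX.1.mem_nhds hX.2.1) hX.analyticAt hφ hφ0 heq
    exact ⟨V, Xc, ρ, φ, φc, hXc, hρ, hφc, hφφ, hφ0, hφ', hinv, hinvc⟩
  · obtain ⟨ρ, δ, hδ, hδρ, hφρ, hgraph⟩ := exists_graph_invariant_timeOneMap hX.analyticAt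
      (hX.apply_zero (by omega)) hφ hφ0 heq hF
    exact ⟨ρ, δ, φ, hδ, hδρ, hφρ, hφ0, hφ', hgraph⟩
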